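/- Let $\mathbb T=\mathbb R/2\pi\mathbb Z$ and $M=\mathbb T_x\times\mathbb R_y\times\mathbb T_z$, and consider on $M$ the (Martinet) sub-Riemannian structure with orthonormal frame $$X_1=\partial_x+\tfrac{y^2}{2}\,\partial_z,\qquad X_2=\partial_y .$$ Let $\mathcal Z=\{y=0\}$. On $M\setminus\mathcal Z$ the fields $X_1,X_2,X_3:=[X_1,X_2]$ form a frame; let $dX_1,dX_2,dX_3$ be the dual coframe. The Popp volume is the density $d\omega=|dX_1\wedge dX_2\wedge dX_3|$ (the null set $\mathcal Z$ is given measure $0$), and the intrinsic sub-Riemannian Laplacian is $\Delta_{sr}\varphi=\operatorname{div}_{\omega}\big(X_1(\varphi)X_1+X_2(\varphi)X_2\big)$, where, for a vector field $Y$ and $d\omega=w\,dx\,dy\,dz$, $\operatorname{div}_\omega Y=w^{-1}\sum_j\partial_j(w\,Y^j)$. Then: 1. the Popp volume is $d\omega=\frac{1}{|y|}\,dx\,dy\,dz$; 2. for every $\varphi\in C^\infty(M\setminus\mathcal Z;\mathbb C)$, on $M\setminus\mathcal Z$, $$\Delta_{sr}\varphi=X_1^2\varphi+X_2^2\varphi-\frac1y\,X_2\varphi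 ;$$ 3. the operator $\Delta_{sr}$ with domain $C_0^\infty(M\setminus\mathcal Z;\mathbb C)$ (smooth functions with compact support in $M\setminus\mathcal Z$) is essentially self-adjoint on $L^2(M,d\omega;\mathbb C)$: it is densely defined and closable, and its closure is self-adjoint. -/

import Mathlib

open MeasureTheory Set Filter Topology
open scoped ContDiff ENNReal

namespace Martinet

noncomputable section

/-- The circle `ℝ / 2πℤ`. -/
abbrev Circ : Type := AddCircle (2 * Real.pi)

instance instFactTwoPiPos : Fact (0 < 2 * Real.pi) := ⟨Real.two_pi_pos⟩

/-- The manifold `M = 𝕋_x × ℝ_y × 𝕋_z`. Its measure `volume` is `dx dy dz`. -/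
abbrev M : Type := Circ × ℝ × Circ

/-- The universal covering `(x, y, z) ↦ ([x], y, [z])`, a local diffeomorphism; smoothness on `M`
is smoothness in the coordinates that it provides. -/
def cover : ℝ × ℝ × ℝ → M := Prod.map (fun x => (x : Circ)) (Prod.map id fun z => (z : Circ))

/-- The coordinate basis `∂_x, ∂_y, ∂_z` of the tangent space. -/
def coordBasis : Fin 3 → ℝ × ℝ × ℝ := ![(1, 0, 0), (0, 1, 0), (0, 0, 1)]

/-- The coordinate `y`. -/
def yCoord (q : M) : ℝ := q.2.1

/-- The Martinet surface `Z = {y = 0}`. -/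
def Z : Set M := {q | yCoord q = 0}

/-- The partial derivative of `f` in the coordinate `j`. -/
def pderiv {F : Type*} [NormedAddCommGroup F] [NormedSpace ℝ F] (j : Fin 3) (f : M → F) (q : M) :
    F :=
  deriv (fun t : ℝ => f (q + cover (t • coordBasis j))) 0

/-- Real vector fields on `M`, given by their components in the frame `∂_x, ∂_y, ∂_z`. -/
abbrev VectorField : Type := M → Fin 3 → ℝ

/-- The derivative `X f` of a function `f` along a vector field `X`. -/
def lieDeriv {F : Type*} [NormedAddCommGroup F] [NormedSpace ℝ F] (X : VectorField) (f : M → F) :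
    M → F :=
  fun q => ∑ j, X q j • pderiv j f q

/-- The Lie bracket `[X, Y] = X Y - Y X` of vector fields. -/
def lieBracket (X Y : VectorField) : VectorField :=
  fun q j => lieDeriv X (fun p => Y p j) q - lieDeriv Y (fun p => X p j) q

/-- The matrix whose columns are the components of `X₁`, `X₂` and `X₃ = [X₁, X₂]` at `q`. -/
def frameMatrix (X₁ X₂ : VectorField) (q : M) : Matrix (Fin 3) (Fin 3) ℝ :=
  Matrix.of fun i j => ![X₁ q i, X₂ q i, lieBracket X₁ X₂ q i] j

/-- The matrix whose rows are the components of the coframe `dX₁, dX₂, dX₃` dual to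
`X₁, X₂, X₃ = [X₁, X₂]`, where the latter is a basis. -/
def dualCoframe (X₁ X₂ : VectorField) (q : M) : Matrix (Fin 3) (Fin 3) ℝ :=
  (frameMatrix X₁ X₂ q)⁻¹

/-- The density with respect to `dx dy dz` of the Popp volume `|dX₁ ∧ dX₂ ∧ dX₃|` of the contact
sub-Riemannian structure with orthonormal frame `X₁, X₂`. -/
def poppDensity (X₁ X₂ : VectorField) (q : M) : ℝ := |(dualCoframe X₁ X₂ q).det|

/-- The Popp volume as a measure. -/
def poppMeasure (X₁ X₂ : VectorField) : Measure M :=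
  volume.withDensity fun q => ENNReal.ofReal (poppDensity X₁ X₂ q)

/-- The (complexified) sub-Riemannian gradient `X₁(φ) X₁ + X₂(φ) X₂` for the orthonormal frame
`X₁, X₂`. -/
def srGradient (X₁ X₂ : VectorField) (φ : M → ℂ) : M → Fin 3 → ℂ :=
  fun q j => X₁ q j • lieDeriv X₁ φ q + X₂ q j • lieDeriv X₂ φ q

/-- The divergence `w⁻¹ ∑ⱼ ∂ⱼ (w Yʲ)` with respect to the volume `w dx dy dz`. -/
def divergence (w : M → ℝ) (Y : M → Fin 3 → ℂ) : M → ℂ :=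
  fun q => (w q)⁻¹ • ∑ j, pderiv j (fun p => w p • Y p j) q

/-- The intrinsic sub-Riemannian Laplacian: the divergence, with respect to the Popp volume, of the
sub-Riemannian gradient. -/
def srLaplacian (X₁ X₂ : VectorField) (φ : M → ℂ) : M → ℂ :=
  divergence (poppDensity X₁ X₂) (srGradient X₁ X₂ φ)

/-- The Martinet field `X₁ = ∂_x + (y² / 2) ∂_z`. -/
def X₁ : VectorField := fun q => ![1, 0, yCoord q ^ 2 / 2]

/-- The Martinet field `X₂ = ∂_y`. -/
def X₂ : VectorField := fun _ => ![0, 1, 0]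

/-- `f` is of class `C^∞` on `M ∖ Z`. -/
def SmoothOff {F : Type*} [NormedAddCommGroup F] [NormedSpace ℝ F] (f : M → F) : Prop :=
  ContDiffOn ℝ ∞ (f ∘ cover) (cover ⁻¹' Zᶜ)

/-- The functions in `C_0^∞(M ∖ Z)`, extended by zero to `M`: the smooth functions whose support is
a compact subset of `M ∖ Z`. -/
structure IsTest (φ : M → ℂ) : Prop where
  smooth : ContDiff ℝ ∞ (φ ∘ cover)
  compact : HasCompactSupport φ
  support : tsupport φ ⊆ Zᶜ

/-! ### Facts needed to define the operator -/

theorem cover_add (v w : ℝ × ℝ × ℝ) : cover (v + w) = cover v + cover w := rfl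

theorem isOpenQuotientMap_cover : IsOpenQuotientMap cover :=
  QuotientAddGroup.isOpenQuotientMap_mk.prodMap
    (IsOpenQuotientMap.id.prodMap QuotientAddGroup.isOpenQuotientMap_mk)

theorem continuous_yCoord : Continuous yCoord := continuous_fst.comp continuous_snd

theorem isClosed_Z : IsClosed Z := isClosed_singleton.preimage continuous_yCoord

theorem yCoord_cover (v : ℝ × ℝ × ℝ) : yCoord (cover v) = v.2.1 := rfl

theorem continuous_shift (q : M) (j : Fin 3) :
    Continuous fun t : ℝ => q + cover (t • coordBasis j) :=
  continuous_const.add (isOpenQuotientMap_cover.continuous.comp (by fun_prop))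

theorem shift_zero (q : M) (j : Fin 3) : q + cover ((0 : ℝ) • coordBasis j) = q := by
  have : cover (0 : ℝ × ℝ × ℝ) = 0 := by simp [cover]; rfl
  simp [this]

/-- Partial derivatives depend only on the germ. -/
theorem pderiv_congr {F : Type*} [NormedAddCommGroup F] [NormedSpace ℝ F] {f g : M → F} {q : M}
    (h : f =ᶠ[𝓝 q] g) (j : Fin 3) : pderiv j f q = pderiv j g q := by
  apply Filter.EventuallyEq.deriv_eq
  have hc := (continuous_shift q j).tendsto 0
  rw [shift_zero] at hc
  exact hc.eventually h

theorem pderiv_cover {F : Type*} [NormedAddCommGroup F] [NormedSpace ℝ F] {f : M → F}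
    {v : ℝ × ℝ × ℝ} (h : DifferentiableAt ℝ (f ∘ cover) v) (j : Fin 3) :
    pderiv j f (cover v) = fderiv ℝ (f ∘ cover) v (coordBasis j) := by
  have h1 : (fun t : ℝ => f (cover v + cover (t • coordBasis j)))
      = fun t : ℝ => (f ∘ cover) (v + t • coordBasis j) := by
    funext t; simp [cover_add]
  rw [pderiv, h1]
  exact h.hasFDerivAt.hasLineDerivAt (coordBasis j) |>.lineDeriv

theorem exists_cover (q : M) : ∃ v, cover v = q := isOpenQuotientMap_cover.surjective q

namespace IsTest

variable {φ ψ : M → ℂ}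

theorem continuous (h : IsTest φ) : Continuous φ :=
  isOpenQuotientMap_cover.isQuotientMap.continuous_iff.2 h.smooth.continuous

theorem eq_zero (h : IsTest φ) {q : M} (hq : yCoord q = 0) : φ q = 0 := by
  by_contra hne
  exact h.support (subset_tsupport φ hne) hq

theorem of_subset (hs : ContDiff ℝ ∞ (ψ ∘ cover)) (h : IsTest φ)
    (hsub : Function.support ψ ⊆ tsupport φ) : IsTest ψ where
  smooth := hs
  compact := h.compact.mono' hsub
  support := (closure_minimal hsub (isClosed_tsupport φ)).trans h.support

theorem zero : IsTest (0 : M → ℂ) where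
  smooth := contDiff_const
  compact := HasCompactSupport.zero
  support := by simp

theorem add (h : IsTest φ) (k : IsTest ψ) : IsTest (φ + ψ) where
  smooth := h.smooth.add k.smooth
  compact := h.compact.add k.compact
  support := (tsupport_add φ ψ).trans (union_subset h.support k.support)

theorem const_smul (c : ℂ) (h : IsTest φ) : IsTest (c • φ) :=
  of_subset (contDiff_const.smul h.smooth) h
    ((Function.support_const_smul_subset c φ).trans (subset_tsupport φ))

theorem smul {g : M → ℝ} (hg : SmoothOff g) (h : IsTest φ) : IsTest fun q => g q • φ q := by
  refine of_subset ?_ h ((Function.support_smul_subset_right g φ).trans (subset_tsupport φ))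
  rw [contDiff_iff_contDiffAt]
  intro v
  by_cases hv : cover v ∈ Z
  · have hn : ∀ᶠ w in 𝓝 v, φ (cover w) = 0 := by
      have := (notMem_tsupport_iff_eventuallyEq.1 fun hm => h.support hm hv)
      exact (isOpenQuotientMap_cover.continuous.tendsto v).eventually this
    refine contDiffAt_const (c := (0 : ℂ)) |>.congr_of_eventuallyEq ?_
    filter_upwards [hn] with w hw
    simp [hw]
  · have ho : IsOpen (cover ⁻¹' Zᶜ) :=
      isClosed_Z.isOpen_compl.preimage isOpenQuotientMap_cover.continuous
    exact (hg.contDiffAt (ho.mem_nhds hv)).smul h.smooth.contDiffAt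

theorem pderiv (j : Fin 3) (h : IsTest φ) : IsTest (pderiv j φ) := by
  refine of_subset ?_ h ?_
  · have : Martinet.pderiv j φ ∘ cover = fun v => fderiv ℝ (φ ∘ cover) v (coordBasis j) := by
      funext v
      exact pderiv_cover (h.smooth.differentiable (by simp)).differentiableAt j
    rw [this]
    exact (h.smooth.fderiv_right (m := ∞) (by simp)).clm_apply contDiff_const
  · intro q hq
    by_contra hn
    apply hq
    rw [pderiv_congr (notMem_tsupport_iff_eventuallyEq.1 hn) j]
    simp [Martinet.pderiv]

theorem sum {f : Fin 3 → M → ℂ} (h : ∀ j, IsTest (f j)) : IsTest fun q => ∑ j, f j q := by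
  have := (h 0).add ((h 1).add (h 2))
  convert this using 1
  funext q
  simp [Fin.sum_univ_three, add_assoc]

theorem lieDeriv {X : VectorField} (hX : ∀ j, SmoothOff fun q => X q j) (h : IsTest φ) :
    IsTest (lieDeriv X φ) :=
  sum fun j => (h.pderiv j).smul (hX j)

end IsTest

theorem pderiv_add {φ ψ : M → ℂ} (h : IsTest φ) (k : IsTest ψ) (j : Fin 3) (q : M) :
    pderiv j (fun p => φ p + ψ p) q = pderiv j φ q + pderiv j ψ q := by
  obtain ⟨v, rfl⟩ := exists_cover q
  have h1 := (h.smooth.differentiable (by simp)).differentiableAt (x := v)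
  have h2 := (k.smooth.differentiable (by simp)).differentiableAt (x := v)
  rw [pderiv_cover h1, pderiv_cover h2, pderiv_cover (f := fun p => φ p + ψ p) (h1.add h2)]
  have : (fun p => φ p + ψ p) ∘ cover = φ ∘ cover + ψ ∘ cover := rfl
  rw [this, fderiv_add h1 h2]
  rfl

theorem pderiv_const_smul {φ : M → ℂ} (h : IsTest φ) (c : ℂ) (j : Fin 3) (q : M) :
    pderiv j (fun p => c • φ p) q = c • pderiv j φ q := by
  obtain ⟨v, rfl⟩ := exists_cover q
  have h1 := (h.smooth.differentiable (by simp)).differentiableAt (x := v)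
  rw [pderiv_cover h1, pderiv_cover (f := fun p => c • φ p) (h1.const_smul c)]
  have : (fun p => c • φ p) ∘ cover = c • (φ ∘ cover) := rfl
  rw [this, fderiv_const_smul h1]
  rfl

theorem smoothOff_yCoord_comp {g : ℝ → ℝ} (hg : ContDiffOn ℝ ∞ g {0}ᶜ) :
    SmoothOff fun q => g (yCoord q) := by
  have : ContDiffOn ℝ ∞ (fun v : ℝ × ℝ × ℝ => v.2.1) (cover ⁻¹' Zᶜ) := by fun_prop
  exact hg.comp this fun v hv => hv

theorem smoothOff_const (c : ℝ) : SmoothOff fun _ => c := contDiffOn_const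

theorem smoothOff_X₁ (j : Fin 3) : SmoothOff fun q => X₁ q j := by
  fin_cases j
  · exact smoothOff_const 1
  · exact smoothOff_const 0
  · exact smoothOff_yCoord_comp (g := fun y => y ^ 2 / 2) (by fun_prop)

theorem smoothOff_X₂ (j : Fin 3) : SmoothOff fun q => X₂ q j := smoothOff_const _

theorem contDiffOn_abs : ContDiffOn ℝ ∞ (fun y : ℝ => |y|) {0}ᶜ := fun _ hy =>
  (contDiffAt_abs hy).contDiffWithinAt

theorem lieBracket_X₁_X₂ (q : M) : lieBracket X₁ X₂ q = ![0, 0, -yCoord q] := by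
  have hc : ∀ (c : ℝ) (i : Fin 3), pderiv i (fun _ => c) q = 0 := by simp [pderiv]
  have hy : pderiv 1 (fun p => yCoord p ^ 2 / 2) q = yCoord q := by
    have : (fun t : ℝ => yCoord (q + cover (t • coordBasis 1)) ^ 2 / 2)
        = fun t : ℝ => (yCoord q + t) ^ 2 / 2 := by
      funext t
      simp [yCoord, cover, coordBasis]
    rw [pderiv, this]
    have hd : HasDerivAt (fun t : ℝ => (yCoord q + t) ^ 2 / 2) (yCoord q) 0 := by
      have := (((hasDerivAt_id (0 : ℝ)).const_add (yCoord q)).pow 2).div_const 2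
      simpa using this
    exact hd.deriv
  funext j
  fin_cases j <;> simp [lieBracket, lieDeriv, Fin.sum_univ_three, X₁, X₂, hc, hy]

theorem poppDensity_eq (q : M) : poppDensity X₁ X₂ q = |yCoord q|⁻¹ := by
  have : (frameMatrix X₁ X₂ q).det = -yCoord q := by
    rw [Matrix.det_fin_three]
    simp [frameMatrix, lieBracket_X₁_X₂, X₁, X₂]
  rw [poppDensity, dualCoframe, Matrix.det_nonsing_inv, this, Ring.inverse_eq_inv', abs_inv,
    abs_neg]

theorem smoothOff_poppDensity : SmoothOff (poppDensity X₁ X₂) := by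
  rw [funext poppDensity_eq]
  exact smoothOff_yCoord_comp (contDiffOn_abs.inv fun y hy => abs_ne_zero.2 hy)

theorem smoothOff_poppDensity_inv : SmoothOff fun q => (poppDensity X₁ X₂ q)⁻¹ := by
  simp only [poppDensity_eq, inv_inv]
  exact smoothOff_yCoord_comp contDiffOn_abs

theorem measurable_poppDensity : Measurable (poppDensity X₁ X₂) := by
  rw [funext poppDensity_eq]
  exact continuous_yCoord.abs.measurable.inv

theorem IsTest.srGradient {φ : M → ℂ} (h : IsTest φ) (j : Fin 3) :
    IsTest fun q => srGradient X₁ X₂ φ q j :=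
  ((h.lieDeriv smoothOff_X₁).smul (smoothOff_X₁ j)).add
    ((h.lieDeriv smoothOff_X₂).smul (smoothOff_X₂ j))

theorem IsTest.srLaplacian {φ : M → ℂ} (h : IsTest φ) : IsTest (srLaplacian X₁ X₂ φ) :=
  (IsTest.sum fun j => ((h.srGradient j).smul smoothOff_poppDensity).pderiv j).smul
    smoothOff_poppDensity_inv

theorem lieDeriv_add (X : VectorField) {φ ψ : M → ℂ} (h : IsTest φ) (k : IsTest ψ) (q : M) :
    lieDeriv X (φ + ψ) q = lieDeriv X φ q + lieDeriv X ψ q := by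
  simp only [lieDeriv, ← Finset.sum_add_distrib, ← smul_add]
  exact Finset.sum_congr rfl fun j _ => congrArg _ (pderiv_add h k j q)

theorem lieDeriv_const_smul (X : VectorField) {φ : M → ℂ} (h : IsTest φ) (c : ℂ) (q : M) :
    lieDeriv X (c • φ) q = c • lieDeriv X φ q := by
  simp only [lieDeriv, Finset.smul_sum]
  refine Finset.sum_congr rfl fun j _ => ?_
  rw [smul_comm c]
  exact congrArg _ (pderiv_const_smul h c j q)

theorem srLaplacian_add {φ ψ : M → ℂ} (h : IsTest φ) (k : IsTest ψ) :
    srLaplacian X₁ X₂ (φ + ψ) = srLaplacian X₁ X₂ φ + srLaplacian X₁ X₂ ψ := by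
  funext q
  simp only [srLaplacian, divergence, Pi.add_apply, ← smul_add, ← Finset.sum_add_distrib]
  congr 1
  refine Finset.sum_congr rfl fun j _ => ?_
  rw [← pderiv_add ((h.srGradient j).smul smoothOff_poppDensity)
    ((k.srGradient j).smul smoothOff_poppDensity)]
  congr 1
  funext p
  simp only [srGradient, lieDeriv_add _ h k, smul_add]
  abel

theorem srLaplacian_const_smul {φ : M → ℂ} (h : IsTest φ) (c : ℂ) :
    srLaplacian X₁ X₂ (c • φ) = c • srLaplacian X₁ X₂ φ := by
  have key : ∀ j q, pderiv j (fun p => poppDensity X₁ X₂ p • srGradient X₁ X₂ (c • φ) p j) q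
      = c • pderiv j (fun p => poppDensity X₁ X₂ p • srGradient X₁ X₂ φ p j) q := by
    intro j q
    rw [← pderiv_const_smul ((h.srGradient j).smul smoothOff_poppDensity)]
    congr 1
    funext p
    simp only [srGradient, lieDeriv_const_smul _ h, smul_add, Complex.real_smul, smul_eq_mul]
    ring
  funext q
  simp only [srLaplacian, divergence, Pi.smul_apply, key, ← Finset.smul_sum]
  exact smul_comm _ _ _

/-- The Popp volume of the Martinet structure. -/
abbrev popp : Measure M := poppMeasure X₁ X₂

theorem IsTest.memLp {φ : M → ℂ} (h : IsTest φ) : MemLp φ 2 popp := by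
  rw [memLp_two_iff_integrable_sq_norm h.continuous.aestronglyMeasurable, popp, poppMeasure,
    integrable_withDensity_iff_integrable_smul' measurable_poppDensity.ennreal_ofReal
      (Eventually.of_forall fun _ => ENNReal.ofReal_lt_top)]
  have hk := h.smul smoothOff_poppDensity
  have : (fun q => (ENNReal.ofReal (poppDensity X₁ X₂ q)).toReal • ‖φ q‖ ^ 2)
      = fun q => ‖poppDensity X₁ X₂ q • φ q‖ * ‖φ q‖ := by
    funext q
    have h0 : 0 ≤ poppDensity X₁ X₂ q := abs_nonneg _
    rw [ENNReal.toReal_ofReal h0, norm_smul, Real.norm_of_nonneg h0, smul_eq_mul]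
    ring
  rw [this]
  exact (hk.continuous.norm.mul h.continuous.norm).integrable_of_hasCompactSupport
    (HasCompactSupport.mul_left h.compact.norm)

theorem IsTest.eq_zero_of_ae {φ : M → ℂ} (h : IsTest φ) (h0 : φ =ᵐ[popp] 0) : φ = 0 := by
  refine (h.continuous.ae_eq_iff_eq volume continuous_zero).1 ?_
  have := (ae_withDensity_iff measurable_poppDensity.ennreal_ofReal).1 h0
  filter_upwards [this] with q hq
  by_cases hy : yCoord q = 0
  · exact h.eq_zero hy
  · exact hq (by simp [poppDensity_eq, hy])

/-! ### The operator -/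

/-- The space `C_0^∞(M ∖ Z)`. -/
def testFunctions : Submodule ℂ (M → ℂ) where
  carrier := {φ | IsTest φ}
  add_mem' := IsTest.add
  zero_mem' := IsTest.zero
  smul_mem' c _ h := IsTest.const_smul c h

/-- The Hilbert space `L²(M, dω)`, where `dω` is the Popp volume. -/
abbrev H : Type := Lp ℂ 2 popp

/-- The inclusion of `C_0^∞(M ∖ Z)` into `L²(M, dω)`. -/
def toH : testFunctions →ₗ[ℂ] H where
  toFun φ := IsTest.memLp φ.2 |>.toLp φ.1
  map_add' φ ψ := MemLp.toLp_add (IsTest.memLp φ.2) (IsTest.memLp ψ.2)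
  map_smul' c φ := MemLp.toLp_const_smul c (IsTest.memLp φ.2)

theorem toH_injective : Function.Injective toH := by
  rw [injective_iff_map_eq_zero]
  intro φ hφ
  have h1 := (MemLp.coeFn_toLp (IsTest.memLp φ.2)).symm
  have h2 : ((IsTest.memLp φ.2).toLp φ.1 : H) = 0 := hφ
  rw [h2] at h1
  exact Subtype.ext (IsTest.eq_zero_of_ae φ.2 (h1.trans (Lp.coeFn_zero ℂ 2 popp)))

/-- `Δ_sr` as a linear map of `C_0^∞(M ∖ Z)` to itself. -/
def srLaplacianTest : testFunctions →ₗ[ℂ] testFunctions where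
  toFun φ := ⟨srLaplacian X₁ X₂ φ.1, IsTest.srLaplacian φ.2⟩
  map_add' φ ψ := Subtype.ext (srLaplacian_add φ.2 ψ.2)
  map_smul' c φ := Subtype.ext (srLaplacian_const_smul φ.2 c)

/-- `Δ_sr` with domain `C_0^∞(M ∖ Z)`, as an unbounded operator on `L²(M, dω)`. -/
def srLaplacianOp : H →ₗ.[ℂ] H where
  domain := LinearMap.range toH
  toFun := toH ∘ₗ srLaplacianTest ∘ₗ (LinearEquiv.ofInjective toH toH_injective).symm.toLinearMap

/-- A densely defined operator is essentially self-adjoint if it is closable and its closure is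
self-adjoint. -/
def IsEssentiallySelfAdjoint {E : Type*} [NormedAddCommGroup E] [InnerProductSpace ℂ E]
    [CompleteSpace E] (T : E →ₗ.[ℂ] E) : Prop :=
  Dense (T.domain : Set E) ∧ T.IsClosable ∧ IsSelfAdjoint T.closure

end

end Martinet

/-! The density and the formula are local computations: $[X_1,X_2]=-y\,\partial_z$ gives the weight
$1/|y|$, and differentiating this weight along $X_2=\partial_y$ produces the term $-\frac1y X_2$.

Essential self-adjointness rests on the deficiency criterion
`isEssentiallySelfAdjoint_of_deficiency`: a symmetric, densely defined operator is essentially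
self-adjoint once nothing nonzero is orthogonal to the ranges of $\Delta_{sr}\pm i$. Symmetry is
integration by parts. A vector orthogonal to the range of $\Delta_{sr}+c$ is, after conjugation, a
weak solution $U\in L^2(d\omega)$ off $\mathcal Z$ (`IsWeakSolution`), and the task is to show $U=0$
whenever $\operatorname{Re}c=0$. The value $c=0$ yields density of the domain as well.

Since the coefficients depend on $y$ only, testing against $e^{ikx}f(y)e^{ilz}$ leaves a weak
ordinary differential equation for each Fourier coefficient $A(y)$ of $U$. On each half-line the
substitution $s=y^2/2$ removes the singular first-order term: if $f(y)=g(s)$ then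
$f''-f'/y=y^2g''(s)$, while $dy/y$ becomes $ds/(2s)$. Thus $B(s)=A(y)$ satisfies $B''=qB$ weakly on
$(0,\infty)$ with $q=((k+ls)^2-c)/(2s)$, so $\operatorname{Re}q\ge0$, and $\int|B|^2\,ds/s<\infty$.

By a du Bois-Reymond argument $B$ has a twice differentiable representative, and
$(|B|^2)''=2\operatorname{Re}q\,|B|^2+2|B'|^2\ge0$. A nonnegative convex function that is positive
at a point stays at least as large on one side of that point, up to the end of the half-line, and
$ds/s$ has infinite mass both near $0$ and near $\infty$. Hence $B=0$
(`ae_eq_zero_of_weak_solution`). No boundary condition at $\mathcal Z$ is needed. Completeness of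
the Fourier system then gives $U=0$. -/

namespace Martinet

noncomputable section

/-! ### Weak solutions on the half-line -/

/-- Smooth functions on `ℝ` whose support is a compact subset of `(0, ∞)`. -/
structure IsHalfLineTest (g : ℝ → ℝ) : Prop where
  smooth : ContDiff ℝ ∞ g
  compact : HasCompactSupport g
  support : tsupport g ⊆ Ioi 0

namespace IsHalfLineTest

variable {g ρ : ℝ → ℝ}

theorem deriv (h : IsHalfLineTest g) : IsHalfLineTest (deriv g) where
  smooth := (contDiff_infty_iff_deriv.1 h.smooth).2
  compact := h.compact.deriv
  support := (closure_minimal (support_deriv_subset) (isClosed_tsupport g)).trans h.support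

theorem hasDerivAt (h : IsHalfLineTest g) (x : ℝ) : HasDerivAt g (_root_.deriv g x) x :=
  (h.smooth.differentiable (by simp)).differentiableAt.hasDerivAt

theorem sub_const_mul (h : IsHalfLineTest g) (hρ : IsHalfLineTest ρ) (c : ℝ) :
    IsHalfLineTest fun x => g x - c * ρ x := by
  have hsub : Function.support (fun x => g x - c * ρ x) ⊆ tsupport g ∪ tsupport ρ := by
    intro x hx
    by_contra hn
    simp only [mem_union, not_or] at hn
    exact hx (by
      simp [image_eq_zero_of_notMem_tsupport hn.1, image_eq_zero_of_notMem_tsupport hn.2])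
  have hcl := closure_minimal hsub ((isClosed_tsupport g).union (isClosed_tsupport ρ))
  exact ⟨h.smooth.sub (contDiff_const.mul hρ.smooth),
    (h.compact.isCompact.union hρ.compact.isCompact).of_isClosed_subset (isClosed_tsupport _) hcl,
    hcl.trans (union_subset h.support hρ.support)⟩

/-- The interval is made to contain $1$ because `primitive` is based there; integration by parts can
then be carried out on $[a,b]$. -/
theorem exists_bounds (h : IsHalfLineTest g) :
    ∃ a b, 0 < a ∧ a < 1 ∧ 1 < b ∧ tsupport g ⊆ Ioo a b := by
  have hK : IsCompact (insert 1 (tsupport g)) := h.compact.isCompact.insert 1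
  obtain ⟨a, ha, ha'⟩ := hK.exists_isLeast (insert_nonempty _ _)
  obtain ⟨b, hb, hb'⟩ := hK.exists_isGreatest (insert_nonempty _ _)
  have ha0 : 0 < a := by
    rcases ha with rfl | ha
    · exact one_pos
    · exact h.support ha
  have ha1 : a ≤ 1 := ha' (mem_insert _ _)
  have hb1 : 1 ≤ b := hb' (mem_insert _ _)
  refine ⟨a / 2, b + 1, by linarith, by linarith, by linarith, fun x hx => ?_⟩
  have hx' : x ∈ insert 1 (tsupport g) := mem_insert_of_mem _ hx
  exact ⟨by linarith [ha' hx'], by linarith [hb' hx']⟩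

theorem integrable_smul (h : IsHalfLineTest g) {B : ℝ → ℂ} (hB : LocallyIntegrableOn B (Ioi 0)) :
    Integrable fun x => g x • B x := by
  obtain ⟨a, b, ha, -, -, hs⟩ := h.exists_bounds
  have h1 : IntegrableOn B (Icc a b) :=
    hB.integrableOn_compact_subset (fun x hx => ha.trans_le hx.1) isCompact_Icc
  have h2 := h1.continuousOn_smul h.smooth.continuous.continuousOn isCompact_Icc
  refine (integrableOn_iff_integrable_of_support_subset fun x hx => ?_).1 h2
  exact Ioo_subset_Icc_self (hs (subset_tsupport g (left_ne_zero_of_smul hx)))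

theorem integral_sub_const_mul_smul (h : IsHalfLineTest g) (hρ : IsHalfLineTest ρ) (c : ℝ)
    {B : ℝ → ℂ} (hB : LocallyIntegrableOn B (Ioi 0)) :
    ∫ x, (g x - c * ρ x) • B x = (∫ x, g x • B x) - c • ∫ x, ρ x • B x := by
  simp only [sub_smul, mul_smul]
  have h1 : Integrable fun x => c • ρ x • B x := (hρ.integrable_smul hB).smul c
  rw [integral_sub (h.integrable_smul hB) h1, integral_smul]

theorem integrable (h : IsHalfLineTest g) : Integrable g :=
  h.smooth.continuous.integrable_of_hasCompactSupport h.compact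

/-- The primitive based to the left of the support vanishes to its right as well, precisely because
the total integral is zero. -/
theorem exists_primitive (h : IsHalfLineTest g) (h0 : ∫ x, g x = 0) :
    ∃ G, IsHalfLineTest G ∧ _root_.deriv G = g := by
  obtain ⟨a, b, ha, ha1, hb1, hsub⟩ := h.exists_bounds
  have hg : ∀ x, x ∉ Ioo a b → g x = 0 := fun x hx =>
    image_eq_zero_of_notMem_tsupport fun hm => hx (hsub hm)
  have hd : ∀ x, HasDerivAt (fun x => ∫ t in a..x, g t) (g x) x := fun x =>
    h.smooth.continuous.integral_hasStrictDerivAt a x |>.hasDerivAt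
  have hd' : _root_.deriv (fun x => ∫ t in a..x, g t) = g := funext fun x => (hd x).deriv
  have hs : Function.support (fun x => ∫ t in a..x, g t) ⊆ Icc a b := by
    intro x hx
    by_contra hn
    apply hx
    rcases lt_or_ge x a with hxa | hxa
    · show ∫ t in a..x, g t = 0
      refine intervalIntegral.integral_zero_ae (ae_of_all _ fun t ht => hg t fun hm => ?_)
      rw [uIoc_comm, uIoc_of_le hxa.le] at ht
      exact absurd hm.1 (not_lt.2 ht.2)
    · have hxb : b < x := by
        by_contra hn'
        exact hn ⟨hxa, not_lt.1 hn'⟩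
      show ∫ t in a..x, g t = 0
      rw [intervalIntegral.integral_eq_integral_of_support_subset, h0]
      intro t ht
      by_contra hn'
      exact ht (hg t fun hm => hn' ⟨hm.1, (hm.2.trans hxb).le⟩)
  have hcl := closure_minimal hs isClosed_Icc
  refine ⟨fun x => ∫ t in a..x, g t, ⟨?_, ?_, ?_⟩, hd'⟩
  · rw [contDiff_infty_iff_deriv, hd']
    exact ⟨fun x => (hd x).differentiableAt, h.smooth⟩
  · exact isCompact_Icc.of_isClosed_subset (isClosed_tsupport _) hcl
  · exact hcl.trans fun x hx => ha.trans_le hx.1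

theorem exists_integral_eq_one : ∃ ρ, IsHalfLineTest ρ ∧ ∫ x, ρ x = 1 := by
  -- Centre $2$ and outer radius $1$ keep the support in $[1,3]$, away from $0$.
  let f : ContDiffBump (2 : ℝ) := ⟨1 / 2, 1, by norm_num, by norm_num⟩
  refine ⟨f.normed volume, ⟨f.contDiff_normed, f.hasCompactSupport_normed, ?_⟩, f.integral_normed⟩
  rw [f.tsupport_normed_eq]
  intro x hx
  rw [Metric.mem_closedBall, Real.dist_eq, abs_le] at hx
  have := hx.1
  change (-1 : ℝ) ≤ x - 2 at this
  exact mem_Ioi.2 (by linarith)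

/-- A functional on test functions that kills derivatives is a multiple of the integral. -/
theorem functional_eq_of_deriv_eq_zero {ℓ : (ℝ → ℝ) → ℂ}
    (hsub : ∀ g ρ c, IsHalfLineTest g → IsHalfLineTest ρ →
      ℓ (fun x => g x - c * ρ x) = ℓ g - c • ℓ ρ)
    (h0 : ∀ g, IsHalfLineTest g → ℓ (_root_.deriv g) = 0) :
    ∃ β : ℂ, ∀ g, IsHalfLineTest g → ℓ g = (∫ x, g x) • β := by
  obtain ⟨ρ, hρ, hρ1⟩ := exists_integral_eq_one
  refine ⟨ℓ ρ, fun g hg => ?_⟩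
  -- Subtracting $(\int g)\rho$ makes the mean zero, so the difference is the derivative of a test
  -- function and is killed by $\ell$.
  have hz : ∫ x, (g x - (∫ x, g x) * ρ x) = 0 := by
    rw [integral_sub hg.integrable (hρ.integrable.const_mul _), integral_const_mul, hρ1]
    ring
  obtain ⟨G, hG, hG'⟩ := (hg.sub_const_mul hρ (∫ x, g x)).exists_primitive hz
  have h1 := hsub g ρ (∫ x, g x) hg hρ
  rw [← hG', h0 G hG] at h1
  exact (sub_eq_zero.1 h1.symm)

end IsHalfLineTest

theorem ae_eq_of_integral_smul_eq {W V : ℝ → ℂ} (hW : LocallyIntegrableOn W (Ioi 0))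
    (hV : LocallyIntegrableOn V (Ioi 0))
    (h : ∀ g, IsHalfLineTest g → ∫ x, g x • W x = ∫ x, g x • V x) :
    ∀ᵐ x, x ∈ Ioi (0 : ℝ) → W x = V x := by
  have := isOpen_Ioi.ae_eq_zero_of_integral_contDiff_smul_eq_zero (hW.sub hV) (μ := volume)
    fun g h1 h2 h3 => by
      have hg : IsHalfLineTest g := ⟨h1, h2, h3⟩
      simp only [Pi.sub_apply, smul_sub]
      rw [integral_sub (hg.integrable_smul hW) (hg.integrable_smul hV), h g hg, sub_self]
  filter_upwards [this] with x hx hx0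
  exact sub_eq_zero.1 (hx hx0)

/-- The du Bois-Reymond lemma. -/
theorem ae_eq_const_of_integral_deriv_smul_eq_zero {W : ℝ → ℂ}
    (hW : LocallyIntegrableOn W (Ioi 0))
    (h : ∀ g, IsHalfLineTest g → ∫ x, deriv g x • W x = 0) :
    ∃ α, ∀ᵐ x, x ∈ Ioi (0 : ℝ) → W x = α := by
  obtain ⟨α, hα⟩ := IsHalfLineTest.functional_eq_of_deriv_eq_zero
    (ℓ := fun g => ∫ x, g x • W x) (fun g ρ c hg hρ => hg.integral_sub_const_mul_smul hρ c hW) h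
  refine ⟨α, ae_eq_of_integral_smul_eq hW ((locallyIntegrable_const α).locallyIntegrableOn _)
    fun g hg => ?_⟩
  rw [hα g hg, integral_smul_const]

/-! ### Primitives and integration by parts on the half-line. -/

theorem intervalIntegrable_of_locallyIntegrableOn {h : ℝ → ℂ}
    (hh : LocallyIntegrableOn h (Ioi 0)) {a b : ℝ} (ha : 0 < a) (hb : 0 < b) :
    IntervalIntegrable h volume a b := by
  rw [intervalIntegrable_iff']
  exact hh.integrableOn_compact_subset (fun x hx => (lt_min ha hb).trans_le hx.1) isCompact_uIcc

/-- The primitive that vanishes at `1`. -/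
def primitive (h : ℝ → ℂ) (s : ℝ) : ℂ := ∫ t in (1 : ℝ)..s, h t

theorem continuousOn_primitive {h : ℝ → ℂ} (hh : LocallyIntegrableOn h (Ioi 0)) :
    ContinuousOn (primitive h) (Ioi 0) := by
  intro s hs
  have hs : 0 < s := hs
  -- The interval from $\min(s/2,1)$ to $\max(s+1,1)$ contains the base point $1$ and is a
  -- neighbourhood of $s$.
  have hm : 0 < min (s / 2) 1 := lt_min (half_pos hs) one_pos
  have := intervalIntegral.continuousOn_primitive_interval'
    (intervalIntegrable_of_locallyIntegrableOn hh hm (b := max (s + 1) 1)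
      (lt_max_of_lt_right one_pos)) (a := 1)
    (by rw [uIcc_of_le ((min_le_right _ _).trans (le_max_right _ _))]
        exact ⟨min_le_right _ _, le_max_right _ _⟩)
  rw [uIcc_of_le ((min_le_right _ _).trans (le_max_right _ _))] at this
  refine (this.continuousAt (Icc_mem_nhds ?_ ?_)).continuousWithinAt
  · exact (min_le_left _ _).trans_lt (by linarith)
  · exact lt_of_lt_of_le (by linarith) (le_max_left _ _)

theorem locallyIntegrableOn_primitive {h : ℝ → ℂ} (hh : LocallyIntegrableOn h (Ioi 0)) :
    LocallyIntegrableOn (primitive h) (Ioi 0) :=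
  (continuousOn_primitive hh).locallyIntegrableOn measurableSet_Ioi

theorem hasDerivAt_primitive {h : ℝ → ℂ} (hh : ContinuousOn h (Ioi 0)) {s : ℝ} (hs : 0 < s) :
    HasDerivAt (primitive h) (h s) s := by
  have hc : ContinuousAt h s := hh.continuousAt (Ioi_mem_nhds hs)
  exact intervalIntegral.integral_hasDerivAt_right
    (intervalIntegrable_of_locallyIntegrableOn (hh.locallyIntegrableOn measurableSet_Ioi)
      one_pos hs)
    (hh.stronglyMeasurableAtFilter isOpen_Ioi s hs) hc

/-- Integration by parts for absolutely continuous functions: $h$ is merely integrable, and its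
primitive has derivative $h$ almost everywhere by Lebesgue differentiation. -/
theorem integral_smul_eq_neg_integral_deriv_smul_primitive_real {h : ℝ → ℝ} {a b : ℝ}
    (h1 : (1 : ℝ) ∈ uIcc a b) (hh : IntervalIntegrable h volume a b) {g : ℝ → ℝ}
    (hg : ContDiff ℝ ∞ g) (ha : g a = 0) (hb : g b = 0) :
    ∫ x in a..b, g x * h x = -∫ x in a..b, deriv g x * ∫ t in (1 : ℝ)..x, h t := by
  have hH := hh.absolutelyContinuousOnInterval_intervalIntegral h1
  have hG : AbsolutelyContinuousOnInterval g a b :=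
    (hg.of_le (by simp)).contDiffOn.absolutelyContinuousOnInterval
  have := hH.integral_mul_deriv_eq_deriv_mul hG
  simp only [ha, hb, mul_zero, sub_zero, zero_sub] at this
  simp only [mul_comm (deriv g _)]
  rw [this, neg_neg]
  refine intervalIntegral.integral_congr_ae ?_
  filter_upwards [hh.ae_hasDerivAt_integral] with x hx hx'
  rw [(hx (uIoc_subset_uIcc hx') 1 h1).deriv, mul_comm]

theorem IsHalfLineTest.integral_smul_eq {g : ℝ → ℝ} (hg : IsHalfLineTest g) {h : ℝ → ℂ}
    (hh : LocallyIntegrableOn h (Ioi 0)) :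
    ∫ x, g x • h x = -∫ x, _root_.deriv g x • primitive h x := by
  obtain ⟨a, b, ha, ha1, hb1, hsub⟩ := hg.exists_bounds
  have hz : ∀ x, x ∉ Ioo a b → g x = 0 := fun x hx =>
    image_eq_zero_of_notMem_tsupport fun hm => hx (hsub hm)
  have hi := intervalIntegrable_of_locallyIntegrableOn hh ha (one_pos.trans hb1)
  have hab : a ≤ b := (ha1.trans hb1).le
  have h1 : (1 : ℝ) ∈ uIcc a b := by rw [uIcc_of_le hab]; exact ⟨ha1.le, hb1.le⟩
  -- Real-linear functionals reduce the identity to the real case; the real and imaginary parts are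
  -- then enough.
  have key : ∀ L : ℂ →L[ℝ] ℝ, L (∫ x, g x • h x) = L (-∫ x, _root_.deriv g x • primitive h x) := by
    intro L
    have hLi : IntervalIntegrable (fun x => L (h x)) volume a b :=
      ⟨L.integrable_comp hi.1, L.integrable_comp hi.2⟩
    rw [map_neg, ← L.integral_comp_comm (hg.integrable_smul hh),
      ← L.integral_comp_comm (hg.deriv.integrable_smul (locallyIntegrableOn_primitive hh)),
      ← intervalIntegral.integral_eq_integral_of_support_subset (a := a) (b := b),
      ← intervalIntegral.integral_eq_integral_of_support_subset (a := a) (b := b)]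
    · simp only [map_smul, smul_eq_mul]
      rw [integral_smul_eq_neg_integral_deriv_smul_primitive_real h1 hLi hg.smooth
        (hz a (by simp)) (hz b (by simp))]
      congr 1
      refine intervalIntegral.integral_congr fun x hx => ?_
      rw [uIcc_of_le hab] at hx
      simp only [primitive]
      rw [L.intervalIntegral_comp_comm
        (intervalIntegrable_of_locallyIntegrableOn hh one_pos (ha.trans_le hx.1))]
    · exact fun x hx => Ioo_subset_Ioc_self
        (hsub (support_deriv_subset fun h0 => hx (by simp [h0])))
    · exact fun x hx => Ioo_subset_Ioc_self
        (hsub (subset_tsupport g fun h0 => hx (by simp [h0])))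
  exact Complex.ext (key Complex.reCLM) (key Complex.imCLM)

/-- The hypothesis says $B'=-h$ weakly, so $B$ plus the primitive of $h$ has zero weak derivative.
-/
theorem exists_ae_eq_primitive {B h : ℝ → ℂ} (hB : LocallyIntegrableOn B (Ioi 0))
    (hh : LocallyIntegrableOn h (Ioi 0))
    (hw : ∀ g, IsHalfLineTest g → ∫ x, deriv g x • B x = ∫ x, g x • h x) :
    ∃ α, ∀ᵐ x, x ∈ Ioi (0 : ℝ) → B x = α - primitive h x := by
  have hP := locallyIntegrableOn_primitive hh
  obtain ⟨α, hα⟩ := ae_eq_const_of_integral_deriv_smul_eq_zero (hB.add hP) fun g hg => by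
    simp only [Pi.add_apply, smul_add]
    rw [integral_add (hg.deriv.integrable_smul hB) (hg.deriv.integrable_smul hP), hw g hg,
      hg.integral_smul_eq hh, neg_add_cancel]
  refine ⟨α, hα.mono fun x hx hx0 => ?_⟩
  rw [← hx hx0, Pi.add_apply, add_sub_cancel_right]

/-- Weak solutions of `B'' = h` are `C¹` with absolutely continuous derivative. -/
theorem exists_ae_eq_primitive_primitive {B h : ℝ → ℂ} (hB : LocallyIntegrableOn B (Ioi 0))
    (hh : LocallyIntegrableOn h (Ioi 0))
    (hw : ∀ g, IsHalfLineTest g → ∫ x, deriv (deriv g) x • B x = ∫ x, g x • h x) :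
    ∃ α β : ℂ, ∀ᵐ x, x ∈ Ioi (0 : ℝ) → B x = α - primitive (fun t => β - primitive h t) x := by
  have hP := locallyIntegrableOn_primitive hh
  -- With $H$ the primitive of $h$, the functional $\ell(g)=\int g'B+\int gH$ vanishes on
  -- derivatives: $\int g''B=\int gh=-\int g'H$. Hence $B'=-(\beta-H)$ weakly, and the first-order
  -- result applies.
  obtain ⟨β, hβ⟩ := IsHalfLineTest.functional_eq_of_deriv_eq_zero
    (ℓ := fun g => (∫ x, deriv g x • B x) + ∫ x, g x • primitive h x)
    (fun g ρ c hg hρ => by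
      have hd : deriv (fun x => g x - c * ρ x) = fun x => deriv g x - c * deriv ρ x := by
        funext x
        exact ((hg.hasDerivAt x).sub ((hρ.hasDerivAt x).const_mul c)).deriv
      simp only [hd]
      rw [hg.deriv.integral_sub_const_mul_smul hρ.deriv c hB,
        hg.integral_sub_const_mul_smul hρ c hP, smul_add]
      ring)
    (fun g hg => by
      rw [hw g hg, hg.integral_smul_eq hh, neg_add_cancel])
  have hβi : LocallyIntegrableOn (fun _ : ℝ => β) (Ioi 0) :=
    (locallyIntegrable_const β).locallyIntegrableOn _
  obtain ⟨α, hα⟩ := exists_ae_eq_primitive hB (h := fun t => β - primitive h t) (hβi.sub hP)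
    fun g hg => by
      simp only [smul_sub]
      rw [integral_sub (hg.integrable_smul hβi) (hg.integrable_smul hP), integral_smul_const,
        ← hβ g hg, add_sub_cancel_right]
  exact ⟨α, β, hα⟩

/-- A nonnegative convex function on `(0, ∞)` which is integrable with respect to `ds / s`
vanishes. -/
theorem eq_zero_of_convexOn_of_integrableOn_div {p : ℝ → ℝ} (hp : ConvexOn ℝ (Ioi 0) p)
    (h0 : ∀ s, 0 ≤ p s) (hi : IntegrableOn (fun s => p s / s) (Ioi 0)) {s : ℝ} (hs : 0 < s) :
    p s = 0 := by
  by_contra hne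
  have hm : 0 < p s := lt_of_le_of_ne (h0 s) (Ne.symm hne)
  have key : ∀ S : Set ℝ, MeasurableSet S → S ⊆ Ioi 0 → (∀ t ∈ S, p s ≤ p t) →
      IntegrableOn (fun t : ℝ => t⁻¹) S := by
    intro S hS hS0 hpS
    have h1 := (hi.mono_set hS0).const_mul (p s)⁻¹
    refine h1.mono' (measurable_inv.aestronglyMeasurable) ?_
    refine (ae_restrict_iff' hS).2 (ae_of_all _ fun t ht => ?_)
    have ht0 : 0 < t := hS0 ht
    rw [Real.norm_of_nonneg (inv_nonneg.2 ht0.le), div_eq_mul_inv, ← mul_assoc]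
    have : 1 ≤ (p s)⁻¹ * p t := by
      rw [inv_mul_eq_div, one_le_div hm]
      exact hpS t ht
    exact le_mul_of_one_le_left (inv_nonneg.2 ht0.le) this
  -- If $p\ge p(s)$ on $(0,s]$, then $1/t$ would be integrable at $0$. Otherwise $p(a)<p(s)$ for
  -- some $a\le s$, and convexity forces $p\ge p(s)$ beyond $s$, so $1/t$ would be integrable at
  -- $\infty$.
  by_cases hleft : ∀ t ∈ Ioc 0 s, p s ≤ p t
  · have h1 := key (Ioc 0 s) measurableSet_Ioc (fun t ht => ht.1) hleft
    rw [← intervalIntegrable_iff_integrableOn_Ioc_of_le hs.le, intervalIntegrable_inv_iff] at h1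
    rcases h1 with h1 | h1
    · exact hs.ne h1
    · exact h1 (by simp)
  · push Not at hleft
    obtain ⟨a, ha, hap⟩ := hleft
    refine not_integrableOn_Ioi_inv (a := s) (key (Ioi s) measurableSet_Ioi
      (fun t ht => hs.trans ht) fun t ht => ?_)
    by_contra hlt
    have := hp.le_max_of_mem_Icc ha.1 (hs.trans ht) ⟨ha.2, le_of_lt ht⟩
    exact absurd this (not_le.2 (max_lt hap (not_le.1 hlt)))

/-- If `B'' = q B` weakly on `(0, ∞)`, where `0 ≤ Re q`, and `|B|²` is integrable with respect to
`ds / s`, then `B = 0`. -/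
theorem ae_eq_zero_of_weak_solution {B q : ℝ → ℂ} (hB : LocallyIntegrableOn B (Ioi 0))
    (hq : ContinuousOn q (Ioi 0)) (hq0 : ∀ s ∈ Ioi (0 : ℝ), 0 ≤ (q s).re)
    (hi : IntegrableOn (fun s => ‖B s‖ ^ 2 / s) (Ioi 0))
    (hw : ∀ g, IsHalfLineTest g → ∫ x, deriv (deriv g) x • B x = ∫ x, g x • (q x * B x)) :
    ∀ᵐ x, x ∈ Ioi (0 : ℝ) → B x = 0 := by
  have hqB : LocallyIntegrableOn (fun x => q x * B x) (Ioi 0) :=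
    hB.continuousOn_mul hq isOpen_Ioi.isLocallyClosed
  obtain ⟨α, β, hαβ⟩ := exists_ae_eq_primitive_primitive hB hqB hw
  -- $C$ is the continuous representative of $B$, and $D=-C'$. Since $B=C$ almost everywhere, $B$
  -- may be replaced by $C$ inside the integral defining $D$, which makes $D$ differentiable with
  -- $D'=-qC$.
  set D : ℝ → ℂ := fun t => β - primitive (fun x => q x * B x) t with hD
  set C : ℝ → ℂ := fun x => α - primitive D x with hC
  have hDc : ContinuousOn D (Ioi 0) := continuousOn_const.sub (continuousOn_primitive hqB)
  have hCd : ∀ s ∈ Ioi (0 : ℝ), HasDerivAt C (-D s) s := fun s hs =>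
    (hasDerivAt_primitive hDc hs).const_sub α
  have hCc : ContinuousOn C (Ioi 0) := fun s hs => (hCd s hs).continuousAt.continuousWithinAt
  have hDC : ∀ s ∈ Ioi (0 : ℝ), D s = β - primitive (fun x => q x * C x) s := by
    intro s hs
    simp only [hD, primitive]
    congr 1
    refine intervalIntegral.integral_congr_ae ?_
    filter_upwards [hαβ] with x hx hx'
    rw [hx (lt_of_lt_of_le (lt_min one_pos hs) (uIoc_subset_uIcc hx').1)]
  have hDd : ∀ s ∈ Ioi (0 : ℝ), HasDerivAt D (-(q s * C s)) s := by
    intro s hs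
    have h1 := (hasDerivAt_primitive (hq.mul hCc) hs).const_sub β
    refine h1.congr_of_eventuallyEq ?_
    filter_upwards [Ioi_mem_nhds hs] with t ht using hDC t ht
  have hconv : ConvexOn ℝ (Ioi 0) fun s => ‖C s‖ ^ 2 := by
    have hd1 : ∀ s ∈ Ioi (0 : ℝ), HasDerivAt (fun s => ‖C s‖ ^ 2) (2 * inner ℝ (C s) (-D s)) s :=
      fun s hs => (hCd s hs).norm_sq
    have hd2 : ∀ s ∈ Ioi (0 : ℝ), HasDerivAt (fun s => 2 * inner ℝ (C s) (-D s))
        (2 * (inner ℝ (C s) (q s * C s) + inner ℝ (-D s) (-D s))) s := by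
      intro s hs
      have h2 := (hDd s hs).neg
      rw [neg_neg] at h2
      exact ((hCd s hs).inner ℝ h2).const_mul 2
    refine convexOn_of_hasDerivWithinAt2_nonneg (convex_Ioi 0)
      (f' := fun s => 2 * inner ℝ (C s) (-D s))
      (f'' := fun s => 2 * (inner ℝ (C s) (q s * C s) + inner ℝ (-D s) (-D s)))
      (fun s hs => (hd1 s hs).continuousAt.continuousWithinAt) ?_ ?_ ?_ <;>
      rw [interior_Ioi]
    · exact fun s hs => (hd1 s hs).hasDerivWithinAt
    · exact fun s hs => (hd2 s hs).hasDerivWithinAt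
    · intro s hs
      have h3 : inner ℝ (C s) (q s * C s) = (q s).re * ‖C s‖ ^ 2 := by
        rw [Complex.inner, mul_assoc, Complex.mul_conj, Complex.re_mul_ofReal,
          Complex.normSq_eq_norm_sq]
      rw [h3]
      have := hq0 s hs
      have h4 : 0 ≤ inner ℝ (-D s) (-D s) := real_inner_self_nonneg
      positivity
  have hCi : IntegrableOn (fun s => ‖C s‖ ^ 2 / s) (Ioi 0) := by
    refine hi.congr ?_
    refine (ae_restrict_iff' measurableSet_Ioi).2 ?_
    filter_upwards [hαβ] with x hx hx0
    rw [hx hx0]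
  filter_upwards [hαβ] with x hx hx0
  rw [hx hx0]
  have := eq_zero_of_convexOn_of_integrableOn_div hconv (fun s => by positivity) hCi hx0
  simpa using this

/-! ### A criterion for essential self-adjointness -/

section Criterion

variable {E : Type*} [NormedAddCommGroup E] [InnerProductSpace ℂ E]

/-- The relation defining the adjoint is a closed condition on the graph element. -/
theorem adjoint_topologicalClosure (g : Submodule ℂ (E × E)) :
    g.topologicalClosure.adjoint = g.adjoint := by
  ext x
  simp only [Submodule.mem_adjoint_iff]
  refine ⟨fun h a b hab => h a b (g.le_topologicalClosure hab), fun h a b hab => ?_⟩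
  have hc : IsClosed {y : E × E | inner ℂ y.2 x.1 - inner ℂ y.1 x.2 = 0} :=
    isClosed_eq (by fun_prop) continuous_const
  exact closure_minimal (fun y hy => h y.1 y.2 hy) hc hab

/-- If `b` lies in the graph of the adjoint of `T` and is orthogonal to the graph of `T`, then it
is zero as soon as `± i` are not eigenvalues of the adjoint. -/
theorem eq_zero_of_adjoint_of_orthogonal {T : E →ₗ.[ℂ] E}
    (h1 : ∀ u : E, (∀ x : T.domain, inner ℂ u (T x + Complex.I • (x : E)) = 0) → u = 0)
    (h2 : ∀ u : E, (∀ x : T.domain, inner ℂ u (T x - Complex.I • (x : E)) = 0) → u = 0)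
    {b₁ b₂ : E} (ha : ∀ x : T.domain, inner ℂ b₂ (x : E) = inner ℂ b₁ (T x))
    (ho : ∀ x : T.domain, inner ℂ b₁ (x : E) + inner ℂ b₂ (T x) = 0) : b₁ = 0 ∧ b₂ = 0 := by
  -- The hypotheses say $T^*b_1=b_2$ and $T^*b_2=-b_1$, so $b_2\pm ib_1$ are eigenvectors of $T^*$
  -- with eigenvalues $\pm i$.
  have e1 : b₂ + Complex.I • b₁ = 0 := h1 _ fun x => by
    simp only [inner_add_left, inner_add_right, inner_smul_left, inner_smul_right, Complex.conj_I]
    rw [ha x, eq_neg_of_add_eq_zero_left (ho x)]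
    linear_combination (inner ℂ b₂ (T x)) * Complex.I_mul_I
  have e2 : b₂ - Complex.I • b₁ = 0 := h2 _ fun x => by
    simp only [inner_sub_left, inner_sub_right, inner_smul_left, inner_smul_right, Complex.conj_I]
    rw [ha x, eq_neg_of_add_eq_zero_left (ho x)]
    linear_combination (inner ℂ b₂ (T x)) * Complex.I_mul_I
  have e3 : (2 : ℂ) • b₂ = 0 := by
    rw [two_smul]
    nth_rewrite 1 [eq_neg_of_add_eq_zero_left e1]
    rw [sub_eq_zero.1 e2, neg_add_cancel]
  have e4 : b₂ = 0 := (smul_eq_zero.1 e3).resolve_left two_ne_zero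
  rw [e4, zero_add] at e1
  exact ⟨(smul_eq_zero.1 e1).resolve_left Complex.I_ne_zero, e4⟩

/-- The basic criterion for essential self-adjointness. -/
theorem isEssentiallySelfAdjoint_of_deficiency [CompleteSpace E] {T : E →ₗ.[ℂ] E}
    (hd : Dense (T.domain : Set E)) (hs : T.IsFormalAdjoint T)
    (h1 : ∀ u : E, (∀ x : T.domain, inner ℂ u (T x + Complex.I • (x : E)) = 0) → u = 0)
    (h2 : ∀ u : E, (∀ x : T.domain, inner ℂ u (T x - Complex.I • (x : E)) = 0) → u = 0) :
    IsEssentiallySelfAdjoint T := by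
  have hle : T ≤ T.adjoint := hs.le_adjoint hd
  have hcl : T.adjoint.IsClosed := T.adjoint_isClosed hd
  have hcable : T.IsClosable := hcl.isClosable.leIsClosable hle
  have hgraph := hcable.graph_closure_eq_closure_graph
  have hadj : T.adjoint.graph = T.graph.adjoint := T.adjoint_graph_eq_graph_adjoint hd
  have hle' : T.graph.topologicalClosure ≤ T.adjoint.graph :=
    Submodule.topologicalClosure_minimal _ (LinearPMap.le_graph_of_le hle) hcl
  have hge : T.adjoint.graph ≤ T.graph.topologicalClosure := by
    intro p hp
    -- The orthogonal splitting of the graph of $T^*$ along the closed graph of $T$ needs the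
    -- Hilbert norm on $E\times E$; the topology is that of the usual product.
    let e := (WithLp.prodContinuousLinearEquiv 2 ℂ E E)
    let K : Submodule ℂ (WithLp 2 (E × E)) :=
      T.graph.topologicalClosure.comap (e : WithLp 2 (E × E) →ₗ[ℂ] E × E)
    have hK : IsClosed (K : Set (WithLp 2 (E × E))) :=
      T.graph.isClosed_topologicalClosure.preimage e.continuous
    have : CompleteSpace K := hK.completeSpace_coe
    obtain ⟨a, ha, b, hb, hab⟩ := K.exists_add_mem_mem_orthogonal (e.symm p)
    have hp' : p = e a + e b := by rw [← map_add, ← hab, e.apply_symm_apply]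
    have hbg : e b ∈ T.adjoint.graph := by
      have : e b = p - e a := by rw [hp', add_sub_cancel_left]
      rw [this]
      exact Submodule.sub_mem _ hp (hle' ha)
    rw [hadj, Submodule.mem_adjoint_iff] at hbg
    have hz := eq_zero_of_adjoint_of_orthogonal h1 h2 (b₁ := (e b).1) (b₂ := (e b).2)
      (fun x => by
        have := hbg x (T x) (T.mem_graph x)
        rw [← inner_conj_symm, ← sub_eq_zero.1 this, inner_conj_symm])
      (fun x => by
        have hx : e.symm ((x : E), T x) ∈ K := by
          show e (e.symm ((x : E), T x)) ∈ T.graph.topologicalClosure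
          rw [e.apply_symm_apply]
          exact T.graph.le_topologicalClosure (T.mem_graph x)
        have := Submodule.inner_left_of_mem_orthogonal hx hb
        rw [WithLp.prod_inner_apply] at this
        exact this)
    have hb0 : e b = 0 := Prod.ext hz.1 hz.2
    rw [hp', hb0, add_zero]
    exact ha
  have hgeq : T.closure.graph = T.adjoint.graph := by
    rw [← hgraph]
    exact le_antisymm hle' hge
  have heq : T.closure = T.adjoint := LinearPMap.eq_of_eq_graph hgeq
  have hd' : Dense (T.closure.domain : Set E) := hd.mono T.le_closure.1
  refine ⟨hd, hcable, ?_⟩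
  rw [LinearPMap.isSelfAdjoint_def]
  apply LinearPMap.eq_of_eq_graph
  -- Passing to the closure does not change the adjoint, so $\overline T^{\,*}=T^*=\overline T$.
  rw [T.closure.adjoint_graph_eq_graph_adjoint hd', ← hgraph, adjoint_topologicalClosure, ← hadj,
    hgraph, hgeq]

end Criterion

/-! ### Calculus on `M` -/

theorem isOpen_cover_preimage_compl_Z : IsOpen (cover ⁻¹' Zᶜ) :=
  isClosed_Z.isOpen_compl.preimage isOpenQuotientMap_cover.continuous

theorem smoothOff_pderiv {F : Type*} [NormedAddCommGroup F] [NormedSpace ℝ F] {f : M → F}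
    (h : SmoothOff f) (j : Fin 3) : SmoothOff (pderiv j f) := by
  have h1 : ContDiffOn ℝ ∞ (fun v => fderiv ℝ (f ∘ cover) v (coordBasis j)) (cover ⁻¹' Zᶜ) :=
    (h.fderiv_of_isOpen isOpen_cover_preimage_compl_Z (m := ∞) (by simp)).clm_apply
      contDiffOn_const
  refine h1.congr fun v hv => ?_
  exact pderiv_cover ((h.contDiffAt (isOpen_cover_preimage_compl_Z.mem_nhds hv)).differentiableAt
    (by simp)) j

theorem SmoothOff.smul {F : Type*} [NormedAddCommGroup F] [NormedSpace ℝ F] {f : M → F}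
    {g : M → ℝ} (hg : SmoothOff g) (h : SmoothOff f) : SmoothOff fun q => g q • f q :=
  ContDiffOn.smul hg h

theorem smoothOff_lieDeriv {X : VectorField} (hX : ∀ j, SmoothOff fun q => X q j) {f : M → ℂ}
    (h : SmoothOff f) : SmoothOff (lieDeriv X f) := by
  have : lieDeriv X f = fun q => (X q 0 • pderiv 0 f q + X q 1 • pderiv 1 f q)
      + X q 2 • pderiv 2 f q := by
    funext q
    simp [lieDeriv, Fin.sum_univ_three]
  rw [this]
  exact (((hX 0).smul (smoothOff_pderiv h 0)).add ((hX 1).smul (smoothOff_pderiv h 1))).add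
    ((hX 2).smul (smoothOff_pderiv h 2))

theorem lieDeriv_X₁ {F : Type*} [NormedAddCommGroup F] [NormedSpace ℝ F] (f : M → F) (q : M) :
    lieDeriv X₁ f q = pderiv 0 f q + (yCoord q ^ 2 / 2) • pderiv 2 f q := by
  simp [lieDeriv, Fin.sum_univ_three, X₁]

theorem lieDeriv_X₂ {F : Type*} [NormedAddCommGroup F] [NormedSpace ℝ F] (f : M → F) :
    lieDeriv X₂ f = pderiv 1 f := by
  funext q
  simp [lieDeriv, Fin.sum_univ_three, X₂]

/-- `f` is differentiable at `q` in the coordinates. -/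
def DiffAt {F : Type*} [NormedAddCommGroup F] [NormedSpace ℝ F] (f : M → F) (q : M) : Prop :=
  ∀ v, cover v = q → DifferentiableAt ℝ (f ∘ cover) v

theorem SmoothOff.diffAt {F : Type*} [NormedAddCommGroup F] [NormedSpace ℝ F] {f : M → F}
    (h : SmoothOff f) {q : M} (hq : q ∉ Z) : DiffAt f q := by
  rintro v rfl
  exact (h.contDiffAt (isOpen_cover_preimage_compl_Z.mem_nhds hq)).differentiableAt (by simp)

theorem IsTest.diffAt {φ : M → ℂ} (h : IsTest φ) (q : M) : DiffAt φ q := fun _ _ =>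
  (h.smooth.differentiable (by simp)).differentiableAt

theorem pderiv_bilin {F G K : Type*} [NormedAddCommGroup F] [NormedSpace ℝ F]
    [NormedAddCommGroup G] [NormedSpace ℝ G] [NormedAddCommGroup K] [NormedSpace ℝ K]
    (b : F →L[ℝ] G →L[ℝ] K) {f : M → F} {g : M → G} {q : M} (hf : DiffAt f q) (hg : DiffAt g q)
    (j : Fin 3) :
    pderiv j (fun p => b (f p) (g p)) q = b (f q) (pderiv j g q) + b (pderiv j f q) (g q) := by
  obtain ⟨v, rfl⟩ := exists_cover q
  have h1 := hf v rfl
  have h2 := hg v rfl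
  have h3 := b.hasFDerivAt_of_bilinear h1.hasFDerivAt h2.hasFDerivAt
  have h4 : DifferentiableAt ℝ ((fun p => b (f p) (g p)) ∘ cover) v := h3.differentiableAt
  rw [pderiv_cover h1, pderiv_cover h2, pderiv_cover h4]
  have h5 : fderiv ℝ ((fun p => b (f p) (g p)) ∘ cover) v = _ := h3.fderiv
  rw [h5]
  simp

theorem pderiv_smul {g : M → ℝ} {f : M → ℂ} {q : M} (hg : DiffAt g q) (hf : DiffAt f q)
    (j : Fin 3) :
    pderiv j (fun p => g p • f p) q = g q • pderiv j f q + pderiv j g q • f q :=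
  pderiv_bilin (ContinuousLinearMap.lsmul ℝ ℝ) hg hf j

theorem pderiv_mul {f g : M → ℂ} {q : M} (hf : DiffAt f q) (hg : DiffAt g q) (j : Fin 3) :
    pderiv j (fun p => f p * g p) q = f q * pderiv j g q + pderiv j f q * g q :=
  pderiv_bilin (ContinuousLinearMap.mul ℝ ℂ) hf hg j

theorem pderiv_conj (f : M → ℂ) (j : Fin 3) (q : M) :
    pderiv j (fun p => (starRingEnd ℂ) (f p)) q = (starRingEnd ℂ) (pderiv j f q) :=
  deriv.star

theorem yCoord_shift (q : M) (j : Fin 3) (t : ℝ) :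
    yCoord (q + cover (t • coordBasis j)) = yCoord q + t * (coordBasis j).2.1 := rfl

theorem pderiv_yCoord_comp {F : Type*} [NormedAddCommGroup F] [NormedSpace ℝ F] (g : ℝ → F)
    (j : Fin 3) (q : M) :
    pderiv j (fun p => g (yCoord p)) q = if j = 1 then deriv g (yCoord q) else 0 := by
  rw [pderiv]
  simp only [yCoord_shift]
  fin_cases j
  · simp [coordBasis]
  · simp [coordBasis, deriv_comp_const_add]
  · simp [coordBasis]

/-- The weight depends on $y$ alone, so only the $\partial_y$ component of the gradient meets its
derivative $-\frac1{|y|}\cdot\frac1y$. The field $X_1$ is divergence-free because its only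
nonconstant component, $y^2/2$ along $\partial_z$, is independent of $z$. -/
theorem srLaplacian_eq {φ : M → ℂ} (h : SmoothOff φ) {q : M} (hq : q ∉ Z) :
    srLaplacian X₁ X₂ φ q = lieDeriv X₁ (lieDeriv X₁ φ) q + lieDeriv X₂ (lieDeriv X₂ φ) q -
      (1 / yCoord q) • lieDeriv X₂ φ q := by
  have hy : yCoord q ≠ 0 := hq
  have hw : poppDensity X₁ X₂ = fun q => |yCoord q|⁻¹ := funext poppDensity_eq
  have h1 := smoothOff_lieDeriv smoothOff_X₁ h
  have h2 := smoothOff_lieDeriv smoothOff_X₂ h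
  set f₁ := lieDeriv X₁ φ with hf₁
  set f₂ := lieDeriv X₂ φ with hf₂
  have hwd : ∀ f : M → ℂ, SmoothOff f → ∀ j, pderiv j (fun p => poppDensity X₁ X₂ p • f p) q
      = poppDensity X₁ X₂ q • pderiv j f q + pderiv j (poppDensity X₁ X₂) q • f q := fun f hf j =>
    pderiv_smul (smoothOff_poppDensity.diffAt hq) (hf.diffAt hq) j
  have hg0 : (fun p => poppDensity X₁ X₂ p • srGradient X₁ X₂ φ p 0)
      = fun p => poppDensity X₁ X₂ p • f₁ p := by
    funext p; simp [srGradient, X₁, X₂, hf₁]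
  have hg1 : (fun p => poppDensity X₁ X₂ p • srGradient X₁ X₂ φ p 1)
      = fun p => poppDensity X₁ X₂ p • f₂ p := by
    funext p; simp [srGradient, X₁, X₂, hf₂]
  have hg2 : (fun p => poppDensity X₁ X₂ p • srGradient X₁ X₂ φ p 2)
      = fun p => poppDensity X₁ X₂ p • ((yCoord p ^ 2 / 2) • f₁ p) := by
    funext p; simp [srGradient, X₁, X₂, hf₁]
  have hs : SmoothOff fun p => yCoord p ^ 2 / 2 := smoothOff_X₁ 2
  have hdw : ∀ j, pderiv j (poppDensity X₁ X₂) q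
      = if j = 1 then -(poppDensity X₁ X₂ q * (1 / yCoord q)) else 0 := by
    intro j
    rw [hw, pderiv_yCoord_comp (fun y => |y|⁻¹)]
    split_ifs
    · have hd : HasDerivAt (fun y : ℝ => |y|⁻¹) (-(SignType.sign (yCoord q) : ℝ) / |yCoord q| ^ 2)
          (yCoord q) := (hasDerivAt_abs hy).inv (abs_ne_zero.2 hy)
      rw [hd.deriv]
      rcases lt_or_gt_of_ne hy with hy' | hy'
      · simp only [sign_neg hy', abs_of_neg hy', SignType.coe_neg, SignType.coe_one]
        field_simp
      · simp only [sign_pos hy', abs_of_pos hy', SignType.coe_one]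
        field_simp
    · rfl
  have hdy : pderiv 2 (fun p => yCoord p ^ 2 / 2) q = 0 := by
    rw [pderiv_yCoord_comp (fun y : ℝ => y ^ 2 / 2)]; simp
  have hw0 : poppDensity X₁ X₂ q ≠ 0 := by
    rw [poppDensity_eq]; exact inv_ne_zero (abs_ne_zero.2 hy)
  rw [srLaplacian, divergence, Fin.sum_univ_three, hg0, hg1, hg2, hwd _ h1, hwd _ h2,
    hwd _ (hs.smul h1), hdw, hdw, hdw, pderiv_smul (hs.diffAt hq) (h1.diffAt hq), hdy,
    lieDeriv_X₁, lieDeriv_X₂]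
  simp only [Fin.reduceEq, if_false, if_true, zero_smul, add_zero, smul_add, neg_smul,
    smul_neg]
  simp only [smul_smul]
  rw [← mul_assoc, inv_mul_cancel₀ hw0]
  simp only [one_smul, one_mul, inv_mul_cancel_left₀ hw0]
  abel

/-! ### Symmetry -/

theorem IsTest.mul {φ ψ : M → ℂ} (h : IsTest φ) (k : IsTest ψ) : IsTest fun q => φ q * ψ q :=
  of_subset (h.smooth.mul k.smooth) h
    ((Function.support_mul_subset_left φ ψ).trans (subset_tsupport φ))

theorem IsTest.conj {φ : M → ℂ} (h : IsTest φ) : IsTest fun q => (starRingEnd ℂ) (φ q) :=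
  of_subset (Complex.conjCLE.contDiff.comp h.smooth) h fun q hq => by
    refine subset_tsupport φ fun h0 => hq ?_
    simp [h0]

theorem IsTest.integrable {φ : M → ℂ} (h : IsTest φ) : Integrable φ :=
  h.continuous.integrable_of_hasCompactSupport h.compact

theorem IsTest.hasDerivAt_shift {φ : M → ℂ} (h : IsTest φ) (j : Fin 3) (q : M) (t : ℝ) :
    HasDerivAt (fun t : ℝ => φ (q + cover (t • coordBasis j)))
      (Martinet.pderiv j φ (q + cover (t • coordBasis j))) t := by
  obtain ⟨v, rfl⟩ := exists_cover q
  have h1 := (h.smooth.differentiable (by simp)).differentiableAt (x := v + t • coordBasis j)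
  rw [← cover_add, pderiv_cover h1]
  have h2 : HasDerivAt (fun t : ℝ => v + t • coordBasis j) (coordBasis j) t := by
    simpa using ((hasDerivAt_id t).smul_const (coordBasis j)).const_add v
  exact h1.hasFDerivAt.comp_hasDerivAt t h2

instance instIsAddRightInvariantVolume : (volume : Measure M).IsAddRightInvariant := by
  have : ((volume : Measure ℝ).prod (volume : Measure Circ)).IsAddRightInvariant := inferInstance
  exact Measure.prod.instIsAddRightInvariant (μ := (volume : Measure Circ))

/-- By translation invariance $\int\varphi(q+te_j)\,dq$ does not depend on $t$; differentiate under
the integral at $t=0$. -/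
theorem integral_pderiv {φ : M → ℂ} (h : IsTest φ) (j : Fin 3) : ∫ q, pderiv j φ q = 0 := by
  have hconst : ∀ t : ℝ, ∫ q, φ (q + cover (t • coordBasis j)) = ∫ q, φ q := fun t =>
    integral_add_right_eq_self φ _
  have hd := h.pderiv j
  obtain ⟨C, hC⟩ := hd.continuous.bounded_above_of_compact_support hd.compact
  -- For $|t|<1$ the translated derivative vanishes off this compact set, so a constant times its
  -- indicator dominates.
  have hK : IsCompact ((fun p : M × ℝ => p.1 - cover (p.2 • coordBasis j)) ''
      (tsupport (pderiv j φ) ×ˢ Icc (-1) 1)) := by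
    refine (hd.compact.isCompact.prod isCompact_Icc).image ?_
    exact continuous_fst.sub (isOpenQuotientMap_cover.continuous.comp (by fun_prop))
  set K := (fun p : M × ℝ => p.1 - cover (p.2 • coordBasis j)) ''
      (tsupport (pderiv j φ) ×ˢ Icc (-1) 1) with hKdef
  have hmain := hasDerivAt_integral_of_dominated_loc_of_deriv_le (μ := (volume : Measure M))
    (F := fun (t : ℝ) q => φ (q + cover (t • coordBasis j)))
    (F' := fun (t : ℝ) q => pderiv j φ (q + cover (t • coordBasis j)))
    (x₀ := 0) (s := Metric.ball 0 1) (bound := K.indicator fun _ => C)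
    (Metric.ball_mem_nhds 0 one_pos)
    (Eventually.of_forall fun t => (h.continuous.comp
      (continuous_id.add continuous_const)).aestronglyMeasurable)
    (h.integrable.comp_add_right _)
    (hd.continuous.comp (continuous_id.add continuous_const)).aestronglyMeasurable
    (ae_of_all _ fun q t ht => by
      by_cases hq : q ∈ K
      · rw [indicator_of_mem hq]; exact hC _
      · rw [indicator_of_notMem hq, norm_le_zero_iff]
        apply image_eq_zero_of_notMem_tsupport
        intro hm
        apply hq
        rw [Metric.mem_ball, dist_zero_right, Real.norm_eq_abs, abs_lt] at ht
        exact ⟨(_, t), ⟨hm, ht.1.le, ht.2.le⟩, add_sub_cancel_right _ _⟩)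
    ((integrable_indicator_iff hK.measurableSet).2
      (integrableOn_const hK.measure_lt_top.ne))
    (ae_of_all _ fun q t _ => h.hasDerivAt_shift j q t)
  have h1 := hmain.2
  simp only [hconst, shift_zero] at h1
  exact h1.unique (hasDerivAt_const 0 _)

theorem integral_conj_pderiv_mul {φ ψ : M → ℂ} (h : IsTest φ) (k : IsTest ψ) (j : Fin 3) :
    ∫ q, (starRingEnd ℂ) (pderiv j φ q) * ψ q = -∫ q, (starRingEnd ℂ) (φ q) * pderiv j ψ q := by
  have h1 := integral_pderiv (h.conj.mul k) j
  have h2 : ∀ q, pderiv j (fun q => (starRingEnd ℂ) (φ q) * ψ q) q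
      = (starRingEnd ℂ) (φ q) * pderiv j ψ q + (starRingEnd ℂ) (pderiv j φ q) * ψ q := fun q => by
    rw [pderiv_mul (h.conj.diffAt q) (k.diffAt q), pderiv_conj]
  simp only [h2] at h1
  rw [integral_add (h.conj.mul (k.pderiv j)).integrable ((h.pderiv j).conj.mul k).integrable] at h1
  exact eq_neg_of_add_eq_zero_right h1

theorem integral_popp (f : M → ℂ) :
    ∫ q, f q ∂popp = ∫ q, poppDensity X₁ X₂ q • f q := by
  rw [popp, poppMeasure, integral_withDensity_eq_integral_toReal_smul
    measurable_poppDensity.ennreal_ofReal (Eventually.of_forall fun _ => ENNReal.ofReal_lt_top)]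
  refine integral_congr_ae (ae_of_all _ fun q => ?_)
  simp only [ENNReal.toReal_ofReal (show 0 ≤ poppDensity X₁ X₂ q from abs_nonneg _)]

/-- The Dirichlet form of `-Δ_sr`. -/
def dirichletForm (φ ψ : M → ℂ) : ℂ :=
  ∫ q, poppDensity X₁ X₂ q • ((starRingEnd ℂ) (lieDeriv X₁ φ q) * lieDeriv X₁ ψ q +
    (starRingEnd ℂ) (lieDeriv X₂ φ q) * lieDeriv X₂ ψ q)

theorem dirichletForm_conj (φ ψ : M → ℂ) :
    (starRingEnd ℂ) (dirichletForm φ ψ) = dirichletForm ψ φ := by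
  rw [dirichletForm, ← integral_conj, dirichletForm]
  refine integral_congr_ae (ae_of_all _ fun q => ?_)
  simp only [Complex.real_smul, map_mul, map_add, Complex.conj_conj, Complex.conj_ofReal]
  ring

/-- The Popp density cancels the factor $w^{-1}$ of the divergence, leaving integration by parts for
$dx\,dy\,dz$. On $\mathcal Z$, where the cancellation fails, $\psi$ vanishes. -/
theorem integral_srLaplacian_mul {φ ψ : M → ℂ} (h : IsTest φ) (k : IsTest ψ) :
    ∫ q, (starRingEnd ℂ) (srLaplacian X₁ X₂ φ q) * ψ q ∂popp = -dirichletForm φ ψ := by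
  set Y : Fin 3 → M → ℂ := fun j p => poppDensity X₁ X₂ p • srGradient X₁ X₂ φ p j with hY
  have hYt : ∀ j, IsTest (Y j) := fun j => (h.srGradient j).smul smoothOff_poppDensity
  rw [integral_popp]
  have h1 : ∀ q, poppDensity X₁ X₂ q • ((starRingEnd ℂ) (srLaplacian X₁ X₂ φ q) * ψ q)
      = ∑ j, (starRingEnd ℂ) (pderiv j (Y j) q) * ψ q := by
    intro q
    by_cases hq : yCoord q = 0
    · simp [k.eq_zero hq]
    · have hw0 : poppDensity X₁ X₂ q ≠ 0 := by
        rw [poppDensity_eq]; exact inv_ne_zero (abs_ne_zero.2 hq)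
      have : (poppDensity X₁ X₂ q : ℂ) ≠ 0 := by exact_mod_cast hw0
      rw [srLaplacian, divergence, ← Finset.sum_mul, ← map_sum]
      simp only [Complex.real_smul, map_mul, Complex.conj_ofReal, ← mul_assoc]
      rw [Complex.ofReal_inv]
      rw [mul_inv_cancel₀ this, one_mul]
      rfl
  simp only [h1]
  rw [integral_finsetSum _ fun j _ => (((hYt j).pderiv j).conj.mul k).integrable]
  simp only [integral_conj_pderiv_mul (hYt _) k]
  rw [Finset.sum_neg_distrib, ← integral_finsetSum _ fun j _ =>
    ((hYt j).conj.mul (k.pderiv j)).integrable, dirichletForm]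
  congr 1
  refine integral_congr_ae (ae_of_all _ fun q => ?_)
  simp only [hY, Fin.sum_univ_three, srGradient, lieDeriv_X₁ ψ, lieDeriv_X₂ ψ, Complex.real_smul,
    map_mul, map_add, Complex.conj_ofReal]
  simp [X₁, X₂]
  ring

/-! ### The operator on $L^2(d\omega)$ and its symmetry. -/

theorem inner_toH (φ ψ : testFunctions) :
    inner ℂ (toH φ) (toH ψ) = ∫ q, (starRingEnd ℂ) (φ.1 q) * ψ.1 q ∂popp := by
  rw [L2.inner_def]
  refine integral_congr_ae ?_
  filter_upwards [MemLp.coeFn_toLp (IsTest.memLp φ.2), MemLp.coeFn_toLp (IsTest.memLp ψ.2)]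
    with q h1 h2
  simp only [toH, LinearMap.coe_mk, AddHom.coe_mk]
  rw [h1, h2, RCLike.inner_apply, mul_comm]

theorem srLaplacianOp_toH (φ : testFunctions) (hφ : toH φ ∈ srLaplacianOp.domain) :
    srLaplacianOp ⟨toH φ, hφ⟩ = toH (srLaplacianTest φ) := by
  have : (LinearEquiv.ofInjective toH toH_injective).symm ⟨toH φ, hφ⟩ = φ := by
    rw [LinearEquiv.symm_apply_eq]
    rfl
  show toH (srLaplacianTest ((LinearEquiv.ofInjective toH toH_injective).symm ⟨toH φ, hφ⟩)) = _
  rw [this]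

theorem isFormalAdjoint_srLaplacianOp : srLaplacianOp.IsFormalAdjoint srLaplacianOp := by
  rintro ⟨_, hφ⟩ ⟨_, hψ⟩
  obtain ⟨φ, rfl⟩ := id hφ
  obtain ⟨ψ, rfl⟩ := id hψ
  rw [srLaplacianOp_toH φ hφ, srLaplacianOp_toH ψ hψ]
  have h1 : ∀ φ ψ : testFunctions,
      inner ℂ (toH (srLaplacianTest φ)) (toH ψ) = -dirichletForm φ.1 ψ.1 := fun φ ψ => by
    rw [inner_toH]
    exact integral_srLaplacian_mul φ.2 ψ.2
  show inner ℂ (toH (srLaplacianTest φ)) (toH ψ) = inner ℂ (toH φ) (toH (srLaplacianTest ψ))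
  rw [← inner_conj_symm (toH φ), h1, h1, map_neg, dirichletForm_conj]

/-! ### The radial equation in the variable `s = y² / 2` -/

/-- The smooth chart `y ↦ y |y| / 2`. -/
def signedSq (y : ℝ) : ℝ := y * |y| / 2

theorem signedSq_of_pos {y : ℝ} (hy : 0 < y) : signedSq y = y ^ 2 / 2 := by
  rw [signedSq, abs_of_pos hy]; ring

theorem hasDerivAt_signedSq {y : ℝ} (hy : y ≠ 0) : HasDerivAt signedSq |y| y := by
  have h := ((hasDerivAt_id y).mul (hasDerivAt_abs hy)).div_const 2
  refine HasDerivAt.congr_deriv (f := signedSq) h ?_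
  rcases lt_or_gt_of_ne hy with h' | h'
  · simp [abs_of_neg h', sign_neg h']
  · simp [abs_of_pos h', sign_pos h']

theorem continuous_signedSq : Continuous signedSq := by unfold signedSq; fun_prop

theorem contDiffAt_signedSq {y : ℝ} (hy : y ≠ 0) : ContDiffAt ℝ ∞ signedSq y :=
  (contDiffAt_id.mul (contDiffAt_abs hy)).div_const 2

theorem hasDerivAt_half_sq (y : ℝ) : HasDerivAt (fun y : ℝ => y ^ 2 / 2) y y := by
  simpa using ((hasDerivAt_id y).pow 2).div_const 2

theorem injOn_half_sq : InjOn (fun y : ℝ => y ^ 2 / 2) (Ioi 0) := fun a ha b hb h => by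
  have h : a ^ 2 / 2 = b ^ 2 / 2 := h
  exact (pow_left_inj₀ (le_of_lt ha) (le_of_lt hb) two_ne_zero).1 (by linarith)

theorem image_half_sq : (fun y : ℝ => y ^ 2 / 2) '' Ioi 0 = Ioi 0 := by
  ext s
  constructor
  · rintro ⟨y, hy, rfl⟩
    have : 0 < y := hy
    exact mem_Ioi.2 (by positivity)
  · intro hs
    have hs : 0 < s := hs
    refine ⟨√(2 * s), Real.sqrt_pos.2 (by positivity), ?_⟩
    show √(2 * s) ^ 2 / 2 = s
    rw [Real.sq_sqrt (by positivity)]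
    ring

theorem sqrt_two_mul_half_sq {y : ℝ} (hy : 0 < y) : √(2 * (y ^ 2 / 2)) = y := by
  rw [mul_div_cancel₀ _ two_ne_zero, Real.sqrt_sq hy.le]

/-- On a compact set $s\le R$, hence $|B|\le1+|B|^2\le1+R\,|B|^2/s$. -/
theorem locallyIntegrableOn_of_integrableOn_sq_div {B : ℝ → ℂ} (hm : Measurable B)
    (hi : IntegrableOn (fun s => ‖B s‖ ^ 2 / s) (Ioi 0)) : LocallyIntegrableOn B (Ioi 0) := by
  rw [locallyIntegrableOn_iff isOpen_Ioi.isLocallyClosed]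
  intro K hK hKc
  obtain ⟨R, hR⟩ := hKc.isBounded.exists_norm_le
  have h1 : IntegrableOn (fun s => 1 + R * (‖B s‖ ^ 2 / s)) K :=
    (integrableOn_const hKc.measure_lt_top.ne).add ((hi.mono_set hK).const_mul R)
  refine Integrable.mono' h1 hm.aestronglyMeasurable ?_
  refine (ae_restrict_iff' hKc.measurableSet).2 (ae_of_all _ fun s hs => ?_)
  have hs0 : 0 < s := hK hs
  have h2 : s ≤ R := (le_abs_self s).trans (hR s hs)
  have h3 : ‖B s‖ ^ 2 ≤ R * (‖B s‖ ^ 2 / s) := by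
    rw [← mul_div_assoc, le_div_iff₀ hs0, mul_comm]
    gcongr
  nlinarith [sq_nonneg (‖B s‖ - 1), norm_nonneg (B s)]

/-- In the variable $s=y^2/2$, with $ds=y\,dy$, the equation becomes $B''=qB$. Since $c$ is purely
imaginary, $\operatorname{Re}q=P^2/(2s)\ge0$. -/
theorem radial_ae_eq_zero {A : ℝ → ℂ} (hm : Measurable A)
    (hi : IntegrableOn (fun y => ‖A y‖ ^ 2 / y) (Ioi 0)) {P : ℝ → ℝ} (hP : Continuous P)
    {c : ℂ} (hc : c.re = 0)
    (hw : ∀ g, IsHalfLineTest g → ∫ y in Ioi 0, ((y⁻¹ : ℝ) : ℂ) *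
      (((y ^ 2 * deriv (deriv g) (y ^ 2 / 2) : ℝ) : ℂ)
        - (((P (y ^ 2 / 2)) ^ 2 : ℝ) - c) * (g (y ^ 2 / 2) : ℝ)) * A y = 0) :
    ∀ᵐ y, y ∈ Ioi (0 : ℝ) → A y = 0 := by
  set B : ℝ → ℂ := fun s => A √(2 * s) with hB
  have hBA : ∀ y ∈ Ioi (0 : ℝ), B (y ^ 2 / 2) = A y := fun y hy => by
    simp only [hB, sqrt_two_mul_half_sq hy]
  have hBm : Measurable B := hm.comp (by fun_prop)
  have hd : ∀ y ∈ Ioi (0 : ℝ), HasDerivWithinAt (fun y : ℝ => y ^ 2 / 2) y (Ioi 0) y :=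
    fun y _ => (hasDerivAt_half_sq y).hasDerivWithinAt
  have hBi : IntegrableOn (fun s => ‖B s‖ ^ 2 / s) (Ioi 0) := by
    rw [← image_half_sq, integrableOn_image_iff_integrableOn_abs_deriv_smul measurableSet_Ioi hd
      injOn_half_sq]
    refine IntegrableOn.congr_fun (f := fun y => 2 * (‖A y‖ ^ 2 / y)) (hi.const_mul 2) (fun y hy => ?_) measurableSet_Ioi
    have hy0 : 0 < y := hy
    simp only [hBA y hy, abs_of_pos hy0, smul_eq_mul]
    field_simp
  have hBl := locallyIntegrableOn_of_integrableOn_sq_div hBm hBi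
  set q : ℝ → ℂ := fun s => (((P s) ^ 2 : ℝ) - c) / ((2 * s : ℝ) : ℂ) with hq
  have hqc : ContinuousOn q (Ioi 0) := by
    refine ContinuousOn.div (by fun_prop) (by fun_prop) fun s hs => ?_
    have hs : 0 < s := hs
    exact_mod_cast (by positivity : 2 * s ≠ 0)
  have hqB : LocallyIntegrableOn (fun x => q x * B x) (Ioi 0) :=
    hBl.continuousOn_mul hqc isOpen_Ioi.isLocallyClosed
  have hzero := ae_eq_zero_of_weak_solution hBl hqc (fun s hs => by
      have hs : 0 < s := hs
      simp only [hq, Complex.div_ofReal_re, Complex.sub_re, Complex.ofReal_re, hc, sub_zero]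
      positivity) hBi (fun g hg => by
      have h0 := hw g hg
      have h1 := integral_image_eq_integral_abs_deriv_smul measurableSet_Ioi hd injOn_half_sq
        (fun s => deriv (deriv g) s • B s - g s • (q s * B s))
      have h2 : ∫ y in Ioi (0 : ℝ), |y| • (deriv (deriv g) (y ^ 2 / 2) • B (y ^ 2 / 2)
          - g (y ^ 2 / 2) • (q (y ^ 2 / 2) * B (y ^ 2 / 2))) = 0 := by
        rw [← h0]
        refine setIntegral_congr_fun measurableSet_Ioi fun y hy => ?_
        have hy0 : 0 < y := hy
        have hyc : (y : ℂ) ≠ 0 := by exact_mod_cast hy0.ne'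
        simp only [hBA y hy, abs_of_pos hy0, hq, Complex.real_smul]
        push_cast
        field_simp
      rw [image_half_sq, h2, setIntegral_eq_integral_of_forall_compl_eq_zero,
        integral_sub (hg.deriv.deriv.integrable_smul hBl) (hg.integrable_smul hqB)] at h1
      · exact sub_eq_zero.1 h1
      · intro s hs
        rw [image_eq_zero_of_notMem_tsupport fun h => hs (hg.support h),
          image_eq_zero_of_notMem_tsupport fun h => hs (hg.deriv.deriv.support h)]
        simp)
  -- Vanishing almost everywhere in $s$ is carried back to $y$ by changing variables in
  -- $\int|B|\,ds=0$; the Jacobian $y$ is nonzero.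
  have hl : ∫⁻ s in Ioi (0 : ℝ), ‖B s‖ₑ = 0 := by
    rw [lintegral_eq_zero_iff hBm.enorm, EventuallyEq, ae_restrict_iff' measurableSet_Ioi]
    filter_upwards [hzero] with s hs hs0
    simp [hs hs0]
  rw [← image_half_sq, lintegral_image_eq_lintegral_abs_deriv_mul measurableSet_Ioi hd
    injOn_half_sq, lintegral_eq_zero_iff (by fun_prop), EventuallyEq,
    ae_restrict_iff' measurableSet_Ioi] at hl
  filter_upwards [hl] with y hy hy0
  have h3 := hy hy0
  have hy1 : 0 < y := hy0
  simpa [hBA y hy0, hy1, hy1.ne'] using h3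

/-! ### Separation of variables -/

/-- The function `e^{ikx} f(y) e^{ilz}`. -/
def mode (k l : ℤ) (f : ℝ → ℂ) : M → ℂ :=
  fun q => fourier k q.1 * f q.2.1 * fourier l q.2.2

theorem hasDerivAt_fourier_circ (k : ℤ) (x : ℝ) :
    HasDerivAt (fun t : ℝ => fourier k (t : Circ)) (Complex.I * k * fourier k (x : Circ)) x := by
  have h := hasDerivAt_fourier (2 * Real.pi) k x
  convert h using 2
  have : (Real.pi : ℂ) ≠ 0 := by exact_mod_cast Real.pi_ne_zero
  push_cast
  field_simp

theorem deriv_fourier_add (k : ℤ) (a : Circ) :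
    deriv (fun t : ℝ => (fourier k (a + (t : Circ)) : ℂ)) 0 = Complex.I * k * fourier k a := by
  induction a using QuotientAddGroup.induction_on with
  | H x =>
    have h := (hasDerivAt_fourier_circ k (x + 0)).comp_const_add x 0
    rw [add_zero] at h
    exact h.deriv

theorem pderiv_mode_zero (k l : ℤ) (f : ℝ → ℂ) :
    pderiv 0 (mode k l f) = mode k l fun y => Complex.I * k * f y := by
  funext q
  have h : (fun t : ℝ => mode k l f (q + cover (t • coordBasis 0)))
      = fun t : ℝ => fourier k (q.1 + (t : Circ)) * (f q.2.1 * fourier l q.2.2) := by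
    funext t
    simp [mode, cover, coordBasis, mul_assoc]
  rw [pderiv, h, deriv_mul_const_field, deriv_fourier_add]
  simp only [mode]
  ring

theorem pderiv_mode_one (k l : ℤ) (f : ℝ → ℂ) :
    pderiv 1 (mode k l f) = mode k l (deriv f) := by
  funext q
  have h : (fun t : ℝ => mode k l f (q + cover (t • coordBasis 1)))
      = fun t : ℝ => fourier k q.1 * f (q.2.1 + t) * fourier l q.2.2 := by
    funext t
    simp [mode, cover, coordBasis]
  rw [pderiv, h, deriv_mul_const_field, deriv_const_mul_field, deriv_comp_const_add, add_zero]
  rfl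

theorem pderiv_mode_two (k l : ℤ) (f : ℝ → ℂ) :
    pderiv 2 (mode k l f) = mode k l fun y => Complex.I * l * f y := by
  funext q
  have h : (fun t : ℝ => mode k l f (q + cover (t • coordBasis 2)))
      = fun t : ℝ => (fourier k q.1 * f q.2.1) * fourier l (q.2.2 + (t : Circ)) := by
    funext t
    simp [mode, cover, coordBasis]
  rw [pderiv, h, deriv_const_mul_field, deriv_fourier_add]
  simp only [mode]
  ring

/-- On a mode $X_1$ is multiplication by $i(k+ly^2/2)$, whence the nonnegative potential $(k+ls)^2$.
-/
theorem lieDeriv_X₁_mode (k l : ℤ) (f : ℝ → ℂ) :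
    lieDeriv X₁ (mode k l f) = mode k l fun y =>
      Complex.I * ((k + l * (y ^ 2 / 2) : ℝ) : ℂ) * f y := by
  funext q
  rw [lieDeriv_X₁, pderiv_mode_zero, pderiv_mode_two]
  simp only [mode, yCoord, Complex.real_smul]
  push_cast
  ring

theorem contDiff_fourier (k : ℤ) : ContDiff ℝ ∞ fun x : ℝ => fourier k (x : Circ) := by
  simp only [fourier_coe_apply]
  have : ContDiff ℝ ∞ fun x : ℝ => (x : ℂ) := Complex.ofRealCLM.contDiff
  fun_prop

theorem isTest_mode (k l : ℤ) {f : ℝ → ℂ} (hf : ContDiff ℝ ∞ f) (hc : HasCompactSupport f)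
    (h0 : (0 : ℝ) ∉ tsupport f) : IsTest (mode k l f) := by
  have hs : Function.support (mode k l f) ⊆ yCoord ⁻¹' tsupport f := fun q hq =>
    subset_tsupport f fun h => hq (by
      have h : f q.2.1 = 0 := h
      simp [mode, h])
  have hcl := closure_minimal hs ((isClosed_tsupport f).preimage continuous_yCoord)
  refine ⟨?_, ?_, ?_⟩
  · exact (((contDiff_fourier k).comp contDiff_fst).mul
      (hf.comp (contDiff_fst.comp contDiff_snd))).mul
      ((contDiff_fourier l).comp (contDiff_snd.comp contDiff_snd))
  · have hK : IsCompact ((univ : Set Circ) ×ˢ (tsupport f ×ˢ (univ : Set Circ))) :=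
      isCompact_univ.prod (hc.isCompact.prod isCompact_univ)
    exact hK.of_isClosed_subset (isClosed_tsupport _) fun q hq => ⟨trivial, hcl hq, trivial⟩
  · intro q hq hZ
    have h1 : yCoord q ∈ tsupport f := hcl hq
    rw [show yCoord q = 0 from hZ] at h1
    exact h0 h1

theorem IsTest.smoothOff {φ : M → ℂ} (h : IsTest φ) : SmoothOff φ := h.smooth.contDiffOn

theorem srLaplacian_mode (k l : ℤ) {f : ℝ → ℂ} (hf : IsTest (mode k l f)) {q : M} (hq : q ∉ Z) :
    srLaplacian X₁ X₂ (mode k l f) q = mode k l (fun y => deriv (deriv f) y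
      - ((1 / y : ℝ) : ℂ) * deriv f y - (((k + l * (y ^ 2 / 2)) ^ 2 : ℝ) : ℂ) * f y) q := by
  rw [srLaplacian_eq hf.smoothOff hq, lieDeriv_X₁_mode, lieDeriv_X₁_mode, lieDeriv_X₂, lieDeriv_X₂,
    pderiv_mode_one, pderiv_mode_one]
  simp only [mode, yCoord, Complex.real_smul]
  push_cast
  linear_combination (fourier k q.1 * ((k : ℂ) + l * ((q.2.1 : ℂ) ^ 2 / 2)) ^ 2 * f q.2.1 *
    fourier l q.2.2) * Complex.I_mul_I

/-- The function `g(± y |y| / 2)`. -/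
def pullback (ε : ℝ) (g : ℝ → ℝ) (y : ℝ) : ℂ := (g (ε * signedSq y) : ℝ)

namespace IsHalfLineTest

variable {g : ℝ → ℝ} {ε : ℝ}

theorem hasDerivAt_pullback (hg : IsHalfLineTest g) {y : ℝ} (hy : y ≠ 0) :
    HasDerivAt (pullback ε g) (((ε * |y| : ℝ) : ℂ) * pullback ε (_root_.deriv g) y) y := by
  have h := ((hg.hasDerivAt _).comp y ((hasDerivAt_signedSq hy).const_mul ε)).ofReal_comp
  refine HasDerivAt.congr_deriv (f := pullback ε g) h ?_
  simp only [pullback]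
  push_cast
  ring

theorem deriv_deriv_pullback (hg : IsHalfLineTest g) (hε : ε * ε = 1) {y : ℝ} (hy : y ≠ 0) :
    _root_.deriv (_root_.deriv (pullback ε g)) y
      - ((1 / y : ℝ) : ℂ) * _root_.deriv (pullback ε g) y
      = ((y ^ 2 : ℝ) : ℂ) * pullback ε (_root_.deriv (_root_.deriv g)) y := by
  have h1 : _root_.deriv (pullback ε g)
      =ᶠ[𝓝 y] fun y => ((ε * |y| : ℝ) : ℂ) * pullback ε (_root_.deriv g) y := by
    filter_upwards [isOpen_ne.mem_nhds hy] with t ht using (hg.hasDerivAt_pullback ht).deriv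
  have h2 := (((hasDerivAt_abs hy).const_mul ε).ofReal_comp).mul
    (hg.deriv.hasDerivAt_pullback (ε := ε) hy)
  rw [h1.deriv_eq, h1.eq_of_nhds]
  have h3 := h2.deriv
  have h4 : (SignType.sign y : ℝ) = |y| / y := by
    rw [eq_div_iff hy, mul_comm, mul_comm y, sign_mul_self]
  have hyc : (y : ℂ) ≠ 0 := by exact_mod_cast hy
  have hεc : (ε : ℂ) * ε = 1 := by exact_mod_cast hε
  have habs : ((|y| : ℝ) : ℂ) * (|y| : ℝ) = (y : ℂ) ^ 2 := by
    rw [← Complex.ofReal_mul, abs_mul_abs_self]; push_cast; ring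
  refine (congrArg (· - _) h3).trans ?_
  rw [h4]
  push_cast
  field_simp
  linear_combination (y : ℂ) * pullback ε (_root_.deriv (_root_.deriv g)) y
    * ((ε : ℂ) * ε * habs + (y : ℂ) ^ 2 * hεc)

theorem tsupport_pullback (hg : IsHalfLineTest g) (hε : ε * ε = 1) :
    HasCompactSupport (pullback ε g) ∧ (0 : ℝ) ∉ tsupport (pullback ε g) := by
  obtain ⟨a, b, ha, ha1, hb1, hs⟩ := hg.exists_bounds
  have hsub : Function.support (pullback ε g) ⊆ (fun y => ε * signedSq y) ⁻¹' Icc a b := fun y hy =>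
    Ioo_subset_Icc_self (hs (subset_tsupport g fun h => hy (by
      simp only [pullback]; rw [h]; simp)))
  have hcl := closure_minimal hsub
    (isClosed_Icc.preimage (continuous_const.mul continuous_signedSq))
  refine ⟨?_, fun h => ?_⟩
  · refine (Metric.isCompact_of_isClosed_isBounded (isClosed_tsupport _) ?_)
    refine (Metric.isBounded_Icc (-(2 * b)) (2 * b)).subset fun y hy => ?_
    have h1 : ε * signedSq y ≤ b := (hcl hy).2
    have h1' : 0 < ε * signedSq y := ha.trans_le (hcl hy).1
    have hεa : |ε| = 1 := by
      have : |ε| * |ε| = 1 := by rw [← abs_mul, hε, abs_one]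
      nlinarith [abs_nonneg ε]
    have h2 : |y| ^ 2 / 2 ≤ b := by
      have h3 : |ε * signedSq y| = |y| ^ 2 / 2 := by
        rw [abs_mul, hεa, signedSq, abs_div, abs_mul, abs_abs, abs_of_pos (zero_lt_two' ℝ)]; ring
      rw [← h3, abs_of_pos h1']
      exact h1
    -- Since $b>1$, $|y|^2\le2b\le(2b)^2$.
    exact abs_le.1 (by nlinarith [abs_nonneg y, sq_nonneg (|y| - 2 * b)])
  · have h1 : a ≤ ε * signedSq 0 := (hcl h).1
    simp [signedSq] at h1
    linarith

/-- The chart `signedSq` is smooth only off $0$, but the pullback vanishes near $0$. -/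
theorem contDiff_pullback (hg : IsHalfLineTest g) (hε : ε * ε = 1) :
    ContDiff ℝ ∞ (pullback ε g) := by
  rw [contDiff_iff_contDiffAt]
  intro y
  by_cases hy : y = 0
  · subst hy
    have := notMem_tsupport_iff_eventuallyEq.1 (hg.tsupport_pullback hε).2
    exact contDiffAt_const.congr_of_eventuallyEq this
  · exact Complex.ofRealCLM.contDiff.contDiffAt.comp y
      (hg.smooth.contDiffAt.comp y (contDiffAt_const.mul (contDiffAt_signedSq hy)))

end IsHalfLineTest

/-! ### Fourier coefficients -/

/-- Cauchy–Schwarz, the character having modulus one. -/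
theorem enorm_integral_fourier_sq_le (k : ℤ) {g : Circ → ℂ} (hg : Measurable g) :
    ‖∫ x, fourier k x * g x‖ₑ ^ 2 ≤ volume (univ : Set Circ) * ∫⁻ x, ‖g x‖ₑ ^ 2 := by
  have h1 : ‖∫ x, fourier k x * g x‖ₑ ≤ ∫⁻ x, (fun _ => 1) x * ‖g x‖ₑ := by
    refine (enorm_integral_le_lintegral_enorm _).trans (le_of_eq ?_)
    refine lintegral_congr fun x => ?_
    rw [enorm_mul, ← ofReal_norm (fourier k x), fourier_apply, Circle.norm_coe, ENNReal.ofReal_one]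
  have h2 := h1.trans (ENNReal.lintegral_mul_le_Lp_mul_Lq volume Real.HolderConjugate.two_two
    aemeasurable_const hg.enorm.aemeasurable)
  have h3 : ∀ a : ℝ≥0∞, (a ^ (1 / 2 : ℝ)) ^ 2 = a := fun a => by
    rw [← ENNReal.rpow_natCast, ← ENNReal.rpow_mul]; norm_num
  calc ‖∫ x, fourier k x * g x‖ₑ ^ 2 ≤ _ := pow_le_pow_left' h2 2
    _ = _ := by
      rw [mul_pow, h3, h3]
      simp

theorem ae_eq_zero_of_integral_fourier_eq_zero {g : Circ → ℂ} (hg : Measurable g)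
    (hfin : ∫⁻ x, ‖g x‖ₑ ^ 2 < ⊤) (h : ∀ k : ℤ, ∫ x, fourier k x * g x = 0) :
    g =ᵐ[volume] 0 := by
  have hL : MemLp g 2 (volume : Measure Circ) := by
    refine ⟨hg.aestronglyMeasurable, ?_⟩
    rw [eLpNorm_lt_top_iff_lintegral_rpow_enorm_lt_top two_ne_zero ENNReal.ofNat_ne_top]
    simpa using hfin
  have hL' : MemLp g 2 (AddCircle.haarAddCircle (T := 2 * Real.pi)) := memLp_haarAddCircle_iff.2 hL
  have h0 : hL'.toLp g = 0 := by
    apply (fourierBasis (T := 2 * Real.pi)).repr.injective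
    rw [map_zero]
    ext i
    rw [fourierBasis_repr, fourierCoeff_congr_ae hL'.coeFn_toLp, fourierCoeff,
      AddCircle.integral_haarAddCircle]
    simp only [smul_eq_mul, h, smul_zero]
    rfl
  have h1 : g =ᵐ[AddCircle.haarAddCircle (T := 2 * Real.pi)] 0 := by
    have := hL'.coeFn_toLp
    rw [h0] at this
    exact this.symm.trans (Lp.coeFn_zero _ _ _)
  rw [AddCircle.volume_eq_smul_haarAddCircle]
  exact Measure.ae_smul_measure h1 _

/-- The partial Fourier coefficient in `x`. -/
def coefX (U : M → ℂ) (k : ℤ) (p : ℝ × Circ) : ℂ := ∫ x, fourier k x * U (x, p)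

/-- The Fourier coefficient in `(x, z)`. -/
def coef (U : M → ℂ) (k l : ℤ) (y : ℝ) : ℂ := ∫ z, fourier l z * coefX U k (y, z)

/-- The square of the norm in `L²(𝕋_x)`. -/
def energyX (U : M → ℂ) (p : ℝ × Circ) : ℝ≥0∞ := ∫⁻ x, ‖U (x, p)‖ₑ ^ 2

/-- The square of the norm in `L²(𝕋_x × 𝕋_z)`. -/
def energy (U : M → ℂ) (y : ℝ) : ℝ≥0∞ := ∫⁻ z, energyX U (y, z)

section

variable {U : M → ℂ}

theorem measurable_coefX (hU : Measurable U) (k : ℤ) : Measurable (coefX U k) := by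
  have h : StronglyMeasurable fun q : M => fourier k q.1 * U q :=
    (((fourier k).continuous.measurable.comp measurable_fst).mul hU).stronglyMeasurable
  exact h.integral_prod_left'.measurable

theorem measurable_coef (hU : Measurable U) (k l : ℤ) : Measurable (coef U k l) := by
  have h : StronglyMeasurable fun q : ℝ × Circ => fourier l q.2 * coefX U k q :=
    (((fourier l).continuous.measurable.comp measurable_snd).mul
      (measurable_coefX hU k)).stronglyMeasurable
  exact h.integral_prod_right'.measurable

theorem measurable_energyX (hU : Measurable U) : Measurable (energyX U) :=
  (hU.enorm.pow_const 2).lintegral_prod_left'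

theorem measurable_energy (hU : Measurable U) : Measurable (energy U) :=
  (measurable_energyX hU).lintegral_prod_right'

theorem measurable_energyX_mk (hU : Measurable U) (y : ℝ) :
    Measurable fun z => energyX U (y, z) :=
  (measurable_energyX hU).comp measurable_prodMk_left

theorem lintegral_mul_sq (hU : Measurable U) {w : ℝ → ℝ≥0∞} (hw : Measurable w) :
    ∫⁻ q : M, w (yCoord q) * ‖U q‖ₑ ^ 2 = ∫⁻ y, w y * energy U y := by
  have hm : Measurable fun q : M => w (yCoord q) * ‖U q‖ₑ ^ 2 :=
    (hw.comp continuous_yCoord.measurable).mul (hU.enorm.pow_const 2)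
  have h1 : ∫⁻ q : M, w (yCoord q) * ‖U q‖ₑ ^ 2 = ∫⁻ p : ℝ × Circ, w p.1 * energyX U p := by
    rw [Measure.volume_eq_prod, lintegral_prod_symm _ hm.aemeasurable]
    refine lintegral_congr fun p => ?_
    rw [energyX, ← lintegral_const_mul _ (by fun_prop)]
    rfl
  have hm' : Measurable fun p : ℝ × Circ => w p.1 * energyX U p :=
    (hw.comp measurable_fst).mul (measurable_energyX hU)
  rw [h1, Measure.volume_eq_prod, lintegral_prod _ hm'.aemeasurable]
  refine lintegral_congr fun y => ?_
  rw [energy, ← lintegral_const_mul _ (measurable_energyX_mk hU y)]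

theorem lintegral_coefX_sq_le (hU : Measurable U) (k : ℤ) (y : ℝ) :
    ∫⁻ z, ‖coefX U k (y, z)‖ₑ ^ 2 ≤ volume (univ : Set Circ) * energy U y := by
  rw [energy, ← lintegral_const_mul _ (measurable_energyX_mk hU y)]
  exact lintegral_mono fun z =>
    enorm_integral_fourier_sq_le k (hU.comp measurable_prodMk_right)

theorem coef_sq_le (hU : Measurable U) (k l : ℤ) (y : ℝ) :
    ‖coef U k l y‖ₑ ^ 2 ≤ volume (univ : Set Circ) ^ 2 * energy U y := by
  refine (enorm_integral_fourier_sq_le l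
    ((measurable_coefX hU k).comp measurable_prodMk_left)).trans ?_
  rw [pow_two, mul_assoc]
  gcongr
  exact lintegral_coefX_sq_le hU k y

theorem integral_mode_mul (k l : ℤ) {f : ℝ → ℂ}
    (hi : Integrable fun q : M => mode k l f q * U q) :
    ∫ q : M, mode k l f q * U q = ∫ y, f y * coef U k l y := by
  rw [Measure.volume_eq_prod] at hi ⊢
  have h1 : ∀ p : ℝ × Circ, ∫ x, mode k l f (x, p) * U (x, p)
      = f p.1 * (fourier l p.2 * coefX U k p) := fun p => by
    rw [coefX, ← mul_assoc, ← integral_const_mul]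
    refine integral_congr_ae (ae_of_all _ fun x => ?_)
    simp only [mode]
    ring
  have hi2 := hi.integral_prod_right
  rw [integral_prod_symm _ hi]
  simp only [h1] at hi2 ⊢
  rw [Measure.volume_eq_prod] at hi2 ⊢
  rw [integral_prod _ hi2]
  refine integral_congr_ae (ae_of_all _ fun y => ?_)
  simp only [coef]
  rw [← integral_const_mul]

/-- Completeness of the characters is used twice at almost every fixed $y$: in $z$, to kill the
partial coefficients, then in $x$, to kill $U$. Finite energy puts the slices in $L^2$ at both
stages. -/
theorem ae_eq_zero_of_coef (hU : Measurable U) (hfin : ∀ᵐ y, energy U y < ⊤)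
    (h : ∀ k l, ∀ᵐ y, coef U k l y = 0) : U =ᵐ[volume] 0 := by
  have hvol : volume (univ : Set Circ) < ⊤ := measure_lt_top _ _
  have hzero : ∀ᵐ y, energy U y = 0 := by
    filter_upwards [hfin, ae_all_iff.2 fun k => ae_all_iff.2 (h k)] with y hy hc
    have hX : ∀ k, (fun z => coefX U k (y, z)) =ᵐ[volume] 0 := fun k =>
      ae_eq_zero_of_integral_fourier_eq_zero ((measurable_coefX hU k).comp measurable_prodMk_left)
        ((lintegral_coefX_sq_le hU k y).trans_lt (ENNReal.mul_lt_top hvol hy)) (hc k)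
    rw [energy, lintegral_eq_zero_iff (measurable_energyX_mk hU y)]
    filter_upwards [ae_all_iff.2 hX, ae_lt_top (measurable_energyX_mk hU y) hy.ne] with z hz hz'
    have hUm : Measurable fun x => U (x, (y, z)) := hU.comp measurable_prodMk_right
    have h0 := ae_eq_zero_of_integral_fourier_eq_zero hUm hz' hz
    show ∫⁻ x, ‖U (x, (y, z))‖ₑ ^ 2 = 0
    rw [lintegral_eq_zero_iff (hUm.enorm.pow_const 2)]
    filter_upwards [h0] with x hx
    simp [hx]
  have h1 := lintegral_mul_sq hU (w := fun _ => 1) measurable_const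
  simp only [one_mul] at h1
  rw [lintegral_congr_ae hzero, lintegral_zero,
    lintegral_eq_zero_iff (hU.enorm.pow_const 2)] at h1
  filter_upwards [h1] with q hq
  simpa using hq

end

/-! ### The deficiency spaces -/

theorem integrable_popp_iff (f : M → ℂ) :
    Integrable f popp ↔ Integrable fun q => poppDensity X₁ X₂ q • f q := by
  rw [popp, poppMeasure, integrable_withDensity_iff_integrable_smul'
    measurable_poppDensity.ennreal_ofReal (Eventually.of_forall fun _ => ENNReal.ofReal_lt_top)]
  simp only [ENNReal.toReal_ofReal (show 0 ≤ poppDensity X₁ X₂ _ from abs_nonneg _)]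

/-- The functions in `L²(dω)` that are weak solutions of `Δ_sr U + c U = 0` on `M ∖ Z`, up to
conjugation. -/
structure IsWeakSolution (c : ℂ) (U : M → ℂ) : Prop where
  measurable : Measurable U
  memLp : MemLp U 2 popp
  eq_zero : ∀ φ, IsTest φ → ∫ q, U q * (srLaplacian X₁ X₂ φ q + c * φ q) ∂popp = 0

namespace IsWeakSolution

variable {U : M → ℂ} {c : ℂ}

theorem measurable_weight_mul_energy (h : IsWeakSolution c U) :
    Measurable fun y : ℝ => ENNReal.ofReal |y|⁻¹ * energy U y :=
  Measurable.mul (by fun_prop) (measurable_energy h.measurable)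

theorem lintegral_energy_lt_top (h : IsWeakSolution c U) :
    ∫⁻ y, ENNReal.ofReal |y|⁻¹ * energy U y < ⊤ := by
  rw [← lintegral_mul_sq h.measurable (w := fun y => ENNReal.ofReal |y|⁻¹) (by fun_prop)]
  have h1 := (eLpNorm_lt_top_iff_lintegral_rpow_enorm_lt_top two_ne_zero
    ENNReal.ofNat_ne_top).1 h.memLp.2
  rw [popp, poppMeasure, lintegral_withDensity_eq_lintegral_mul _
    measurable_poppDensity.ennreal_ofReal (h.measurable.enorm.pow_const _)] at h1
  simpa [poppDensity_eq] using h1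

theorem energy_lt_top (h : IsWeakSolution c U) : ∀ᵐ y, energy U y < ⊤ := by
  have h0 : ∀ᵐ y : ℝ, y ≠ 0 := by simp [ae_iff, measure_singleton]
  filter_upwards [ae_lt_top h.measurable_weight_mul_energy h.lintegral_energy_lt_top.ne, h0] with y hy hy0
  refine ENNReal.lt_top_of_mul_ne_top_right hy.ne ?_
  simpa using hy0

theorem integrable_coef_sq (h : IsWeakSolution c U) (k l : ℤ) :
    Integrable fun y => |y|⁻¹ * ‖coef U k l y‖ ^ 2 := by
  have hm := measurable_coef h.measurable k l
  refine ⟨(Measurable.mul (by fun_prop) (hm.norm.pow_const 2)).aestronglyMeasurable, ?_⟩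
  have h1 : ∫⁻ y, volume (univ : Set Circ) ^ 2 * (ENNReal.ofReal |y|⁻¹ * energy U y) < ⊤ := by
    rw [lintegral_const_mul _ h.measurable_weight_mul_energy]
    exact ENNReal.mul_lt_top (ENNReal.pow_lt_top (measure_lt_top _ _)) h.lintegral_energy_lt_top
  refine lt_of_le_of_lt (lintegral_mono fun y => ?_) h1
  rw [enorm_mul, enorm_pow, enorm_norm, Real.enorm_of_nonneg (by positivity)]
  calc _ ≤ ENNReal.ofReal |y|⁻¹ * (volume (univ : Set Circ) ^ 2 * energy U y) := by
        gcongr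
        exact coef_sq_le h.measurable k l y
    _ = _ := by ring

/-- The equation satisfied by the Fourier coefficients. -/
theorem integral_coef_eq_zero (h : IsWeakSolution c U) (k l : ℤ) {f : ℝ → ℂ}
    (hf : IsTest (mode k l f)) :
    ∫ y, ((|y|⁻¹ : ℝ) : ℂ) * (deriv (deriv f) y - ((1 / y : ℝ) : ℂ) * deriv f y
      - (((k + l * (y ^ 2 / 2)) ^ 2 : ℝ) - c) * f y) * coef U k l y = 0 := by
  set F : ℝ → ℂ := fun y => ((|y|⁻¹ : ℝ) : ℂ) * (deriv (deriv f) y - ((1 / y : ℝ) : ℂ) * deriv f y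
      - (((k + l * (y ^ 2 / 2)) ^ 2 : ℝ) - c) * f y) with hF
  have hψ : IsTest fun q => srLaplacian X₁ X₂ (mode k l f) q + c * mode k l f q :=
    hf.srLaplacian.add (hf.const_smul c)
  have hi := h.memLp.integrable_mul hψ.memLp
  have h0 := h.eq_zero _ hf
  have heq : (fun q => poppDensity X₁ X₂ q •
      (U q * (srLaplacian X₁ X₂ (mode k l f) q + c * mode k l f q)))
      = fun q => mode k l F q * U q := by
    funext q
    -- On $\mathcal Z$ both sides vanish through the convention $0^{-1}=0$.
    by_cases hq : q ∈ Z
    · have hy : yCoord q = 0 := hq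
      have hy' : q.2.1 = 0 := hq
      simp [poppDensity_eq, hy, hF, mode, hy']
    · rw [srLaplacian_mode k l hf hq, poppDensity_eq]
      simp only [mode, hF, yCoord, Complex.real_smul]
      ring
  rw [integrable_popp_iff] at hi
  rw [integral_popp] at h0
  simp only [Pi.mul_apply] at hi
  rw [heq] at hi h0
  rwa [integral_mode_mul k l hi] at h0

/-- The sign $\varepsilon$ selects the half-line: `pullback ε g` is supported where $\varepsilon
y>0$, and the reflection $y\mapsto\varepsilon y$ reduces both sides to the radial equation on
$(0,\infty)$. -/
theorem ae_coef_mul_eq_zero (h : IsWeakSolution c U) (hc : c.re = 0) (k l : ℤ) {ε : ℝ}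
    (hε : ε = 1 ∨ ε = -1) : ∀ᵐ y, y ∈ Ioi (0 : ℝ) → coef U k l (ε * y) = 0 := by
  have hε2 : ε * ε = 1 := by rcases hε with rfl | rfl <;> norm_num
  have hεa : |ε| = 1 := by rcases hε with rfl | rfl <;> norm_num
  have hsub : ∀ F : ℝ → ℂ, ∫ y, F y = ∫ y, F (ε * y) := fun F => by
    rw [Measure.integral_comp_mul_left, abs_inv, hεa, inv_one, one_smul]
  refine radial_ae_eq_zero ((measurable_coef h.measurable k l).comp (measurable_const_mul ε))
    (P := fun s => k + l * s) ?_ (by fun_prop) hc fun g hg => ?_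
  · have h1 : Integrable fun y => |ε * y|⁻¹ * ‖coef U k l (ε * y)‖ ^ 2 :=
      (h.integrable_coef_sq k l).comp_mul_left' (by rintro rfl; norm_num at hε2)
    refine h1.integrableOn.congr_fun (fun y hy => ?_) measurableSet_Ioi
    have hy : 0 < y := hy
    simp only [abs_mul, hεa, one_mul, abs_of_pos hy, div_eq_inv_mul]
  · have hp : ∀ (g : ℝ → ℝ) (y : ℝ), pullback ε g (ε * y) = (g (signedSq y) : ℝ) := fun g y => by
      simp only [pullback, signedSq, abs_mul, hεa, one_mul]
      congr 2
      linear_combination (y * |y| / 2) * hε2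
    have h0 := h.integral_coef_eq_zero k l (isTest_mode k l (hg.contDiff_pullback hε2)
      (hg.tsupport_pullback hε2).1 (hg.tsupport_pullback hε2).2)
    rw [hsub, ← setIntegral_eq_integral_of_forall_compl_eq_zero (s := Ioi 0)] at h0
    · rw [← h0]
      refine setIntegral_congr_fun measurableSet_Ioi fun y hy => ?_
      have hy : 0 < y := hy
      have hne : ε * y ≠ 0 := mul_ne_zero (by rintro rfl; norm_num at hε2) hy.ne'
      simp only [hg.deriv_deriv_pullback hε2 hne, hp, signedSq_of_pos hy,
        abs_mul, hεa, one_mul, abs_of_pos hy, mul_pow, pow_two ε, hε2, Complex.ofReal_mul]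
    · intro y hy
      have hy : y ≤ 0 := not_lt.1 hy
      rcases hy.eq_or_lt with rfl | hy
      · simp
      have hne : ε * y ≠ 0 := mul_ne_zero (by rintro rfl; norm_num at hε2) hy.ne
      have hs : signedSq y ∉ Ioi (0 : ℝ) := by
        rw [mem_Ioi, not_lt, signedSq]
        have := mul_nonpos_of_nonpos_of_nonneg hy.le (abs_nonneg y)
        linarith
      rw [hg.deriv_deriv_pullback hε2 hne, hp, hp,
        image_eq_zero_of_notMem_tsupport fun h => hs (hg.support h),
        image_eq_zero_of_notMem_tsupport fun h => hs (hg.deriv.deriv.support h)]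
      simp

theorem ae_coef_eq_zero (h : IsWeakSolution c U) (hc : c.re = 0) (k l : ℤ) :
    ∀ᵐ y, coef U k l y = 0 := by
  have h1 := h.ae_coef_mul_eq_zero hc k l (Or.inl rfl)
  have h2 := (Measure.measurePreserving_neg (volume : Measure ℝ)).quasiMeasurePreserving.ae
    (h.ae_coef_mul_eq_zero hc k l (Or.inr rfl))
  have h0 : ∀ᵐ y : ℝ, y ≠ 0 := by simp [ae_iff, measure_singleton]
  filter_upwards [h0, h1, h2] with y hy hy1 hy2
  rcases lt_or_gt_of_ne hy with hy' | hy'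
  · simpa using hy2 (neg_pos.2 hy')
  · simpa using hy1 hy'

theorem ae_eq_zero (h : IsWeakSolution c U) (hc : c.re = 0) : U =ᵐ[popp] 0 :=
  (withDensity_absolutelyContinuous _ _).ae_eq
    (ae_eq_zero_of_coef h.measurable h.energy_lt_top (h.ae_coef_eq_zero hc))

end IsWeakSolution

/-- Conjugating $u$ turns the inner product into the bilinear pairing of `IsWeakSolution`. The
values $c=\pm i$ serve the deficiency spaces and $c=0$ the density of the domain. -/
theorem eq_zero_of_inner_toH {c : ℂ} (hc : c.re = 0) {u : H}
    (h : ∀ φ : testFunctions, inner ℂ u (toH (srLaplacianTest φ) + c • toH φ) = 0) : u = 0 := by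
  have hw : IsWeakSolution c fun q => (starRingEnd ℂ) (u q) := by
    refine ⟨Complex.continuous_conj.measurable.comp (Lp.stronglyMeasurable u).measurable,
      (Lp.memLp u).star, fun φ hφ => ?_⟩
    have h1 := h ⟨φ, hφ⟩
    rw [← map_smul, ← map_add, L2.inner_def] at h1
    rw [← h1]
    refine integral_congr_ae ?_
    have h2 := MemLp.coeFn_toLp (IsTest.memLp (srLaplacianTest ⟨φ, hφ⟩ + c • ⟨φ, hφ⟩).2)
    filter_upwards [h2] with q hq
    have h3 : (toH (srLaplacianTest ⟨φ, hφ⟩ + c • ⟨φ, hφ⟩)) q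
        = srLaplacian X₁ X₂ φ q + c * φ q := hq
    rw [h3, RCLike.inner_apply, mul_comm]
  rw [Lp.eq_zero_iff_ae_eq_zero]
  filter_upwards [hw.ae_eq_zero hc] with q hq
  simpa using hq

/-- $\Delta_{sr}$ preserves the test functions, so a vector orthogonal to all of them is in
particular a weak solution for $c=0$. -/
theorem dense_domain_srLaplacianOp : Dense (srLaplacianOp.domain : Set H) := by
  rw [Submodule.dense_iff_topologicalClosure_eq_top,
    Submodule.topologicalClosure_eq_top_iff, Submodule.eq_bot_iff]
  refine fun u hu => eq_zero_of_inner_toH (c := 0) rfl fun φ => ?_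
  exact Submodule.inner_left_of_mem_orthogonal (Submodule.add_mem _ (LinearMap.mem_range_self toH _)
    (Submodule.smul_mem _ _ (LinearMap.mem_range_self toH _))) hu

theorem isEssentiallySelfAdjoint_srLaplacianOp : IsEssentiallySelfAdjoint srLaplacianOp := by
  refine isEssentiallySelfAdjoint_of_deficiency dense_domain_srLaplacianOp
    isFormalAdjoint_srLaplacianOp
    (fun u hu => eq_zero_of_inner_toH (c := Complex.I) Complex.I_re fun φ => ?_)
    (fun u hu => eq_zero_of_inner_toH (c := -Complex.I) (by simp) fun φ => ?_)
  · have hφ : toH φ ∈ srLaplacianOp.domain := ⟨φ, rfl⟩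
    rw [← srLaplacianOp_toH φ hφ]
    exact hu ⟨toH φ, hφ⟩
  · have hφ : toH φ ∈ srLaplacianOp.domain := ⟨φ, rfl⟩
    rw [← srLaplacianOp_toH φ hφ, neg_smul, ← sub_eq_add_neg]
    exact hu ⟨toH φ, hφ⟩

end

end Martinet

theorem mainTheorem5 :
    -- the density of the Popp volume
    (∀ q ∉ Martinet.Z,
      Martinet.poppDensity Martinet.X₁ Martinet.X₂ q = 1 / |Martinet.yCoord q|) ∧
    Martinet.poppMeasure Martinet.X₁ Martinet.X₂ =
      volume.withDensity (fun q => ENNReal.ofReal (1 / |Martinet.yCoord q|)) ∧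
    -- the formula for the intrinsic Laplacian
    (∀ φ : Martinet.M → ℂ, Martinet.SmoothOff φ → ∀ q ∉ Martinet.Z,
      Martinet.srLaplacian Martinet.X₁ Martinet.X₂ φ q =
        Martinet.lieDeriv Martinet.X₁ (Martinet.lieDeriv Martinet.X₁ φ) q +
          Martinet.lieDeriv Martinet.X₂ (Martinet.lieDeriv Martinet.X₂ φ) q -
          (1 / Martinet.yCoord q) • Martinet.lieDeriv Martinet.X₂ φ q) ∧
    -- essential self-adjointness
    Martinet.IsEssentiallySelfAdjoint Martinet.srLaplacianOp := by
  refine ⟨fun q _ => ?_, ?_, fun φ hφ q hq => Martinet.srLaplacian_eq hφ hq,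
    Martinet.isEssentiallySelfAdjoint_srLaplacianOp⟩
  · rw [Martinet.poppDensity_eq, one_div]
  · simp only [Martinet.poppMeasure, Martinet.poppDensity_eq, one_div]
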